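/- Let $(\Theta_k)_{k\ge 0}$, $(\Phi_k)_{k\ge 0}$ be random variables, all jointly independent, where $\Theta_k$ has density $\frac12\cos\theta$ on $(-\pi/2,\pi/2)$ and $\Phi_k$ is uniform on $[-\pi/2,\pi/2]$. They describe a light ray reflected inside the cylinder $\{y^2+z^2=1,\ x\le 0\}$ and starting at $(-s,0,-1)$: put $S_0=(0,0,-1)$, $R_k=\dfrac{2\cos\Theta_k}{\sin^2\Phi_k\sin^2\Theta_k+\cos^2\Theta_k}$ and, for $k\ge 0$, \begin{align*} S^x_{k+1}&=S^x_k+R_k\cos\Phi_k\sin\Theta_k,\\ S^y_{k+1}&=S^y_k+R_k(-S^z_k\sin\Phi_k\sin\Theta_k-S^y_k\cos\Theta_k),\\ S^z_{k+1}&=S^z_k+R_k(S^y_k\sin\Phi_k\sin\Theta_k-S^z_k\cos\Theta_k), \end{align*} so that the reflection points are $(S^x_k-s,S^y_k,S^z_k)$. For $s\ge 0$ let $N_s=\inf\{n>0: S^x_n>s\}$, $O_s=S^x_{N_s}-s$, $U_s=s-S^x_{N_s-1}$, and let $$Y_s=\frac{s-S^x_{N_s-1}}{S^x_{N_s}-S^x_{N_s-1}}\,\bigl(S^y_{N_s}-S^y_{N_s-1},\,S^z_{N_s}-S^z_{N_s-1}\bigr)+\bigl(S^y_{N_s-1},S^z_{N_s-1}\bigr)$$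 be the point, in $(y,z)$-coordinates, at which the ray crosses the opening $\partial_rC=\{(y,z): y^2+z^2\le 1\}$ of the tube. For $t\in(0,1)$ and $y_0^2+z_0^2=1$ let $D_t(y_0,z_0)=\{(y,z):(y-(1-t)y_0)^2+(z-(1-t)z_0)^2\le t^2\}$, and let $\mathrm{Leb}$ be Lebesgue measure on the plane; the areas of $D_t(y_0,z_0)$ and $\partial_rC\setminus D_t(y_0,z_0)$ do not depend on the point $(y_0,z_0)$ of the unit circle. Then $N_s<\infty$ almost surely for every $s\ge 0$, $\mathbb{E}[O_0]\in(0,\infty)$, $O_0+U_0$ is integrable, the limits as $s\to\infty$ below exist for every $t\in(0,1)$, and: (a) $$\lim_{t\to 0^+}\frac{\lim_{s\to \infty} \mathbb{P} ( Y_s \in D_t(S^y_{N_s-1}, S^z_{N_s-1}) )}{\mathrm{Leb}(D_t(S^y_{N_s-1}, S^z_{N_s-1}))}=\infty;$$ (b) $$\lim_{t\to 1^-}\frac{\lim_{s\to \infty} \mathbb{P} ( Y_s \in \partial_r C \setminus D_t(S^y_{N_s-1}, S^z_{N_s-1}))}{\mathrm{Leb}(\partial_r C \setminus D_t(S^y_{N_s-1},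 S^z_{N_s-1}))}=\frac{\mathbb{E}[O_0+U_0]}{2\pi\,\mathbb{E}[O_0]}.$$ -/

import Mathlib

open Real Set Filter Topology MeasureTheory ProbabilityTheory

noncomputable section

namespace LambertTube

/-- The law on `ℝ` with density `cos θ / 2` on `(-π/2, π/2)` and `0` elsewhere: the law of the
angle `Θ` between a reflected ray and the inward normal. -/
def lambertLaw : Measure ℝ :=
  volume.withDensity fun θ => ENNReal.ofReal (if θ ∈ Ioo (-(π / 2)) (π / 2) then cos θ / 2 else 0)

/-- Distance travelled between two consecutive reflections, along a ray which forms the angle `θ`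
with the normal and whose projection on the tangent plane forms the angle `φ` with the
`x`-direction. -/
def chord (θ φ : ℝ) : ℝ :=
  2 * cos θ / (sin φ ^ 2 * sin θ ^ 2 + cos θ ^ 2)

/-- The process `S_k = (S^x_k, S^y_k, S^z_k)` of reflection points, started from `(0, 0, -1)`;
the ray leaving the `k`-th point has the angles `(θ k, φ k)`. If the light starts at
`(-s, 0, -1)`, the `k`-th reflection point on the cylinder is `(S^x_k - s, S^y_k, S^z_k)`. -/
def S (θ φ : ℕ → ℝ) : ℕ → ℝ × ℝ × ℝ
  | 0 => (0, 0, -1)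
  | k + 1 =>
    let x := (S θ φ k).1
    let y := (S θ φ k).2.1
    let z := (S θ φ k).2.2
    let R := chord (θ k) (φ k)
    (x + R * (cos (φ k) * sin (θ k)),
      y + R * (-z * sin (φ k) * sin (θ k) - y * cos (θ k)),
      z + R * (y * sin (φ k) * sin (θ k) - z * cos (θ k)))

/-- `N_s = inf {n > 0 : S^x_n > s}`: the light leaves the tube between the reflection points
with numbers `N_s - 1` and `N_s`. -/
def N (s : ℝ) (θ φ : ℕ → ℝ) : ℕ :=
  sInf {n : ℕ | 0 < n ∧ s < (S θ φ n).1}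

/-- The overshoot `O_s = S^x_{N_s} - s`. -/
def overshoot (s : ℝ) (θ φ : ℕ → ℝ) : ℝ :=
  (S θ φ (N s θ φ)).1 - s

/-- The undershoot `U_s = s - S^x_{N_s - 1}`. -/
def undershoot (s : ℝ) (θ φ : ℕ → ℝ) : ℝ :=
  s - (S θ φ (N s θ φ - 1)).1

/-- The `(y, z)`-coordinates `(S^y_{N_s - 1}, S^z_{N_s - 1})` of the last reflection point before
the exit. -/
def lastPoint (s : ℝ) (θ φ : ℕ → ℝ) : ℝ × ℝ :=
  (S θ φ (N s θ φ - 1)).2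

/-- The `(y, z)`-coordinates of the exit point `Y_s`, at which the segment from the last reflection
point inside the tube to the next one crosses the plane of the opening. -/
def exitPoint (s : ℝ) (θ φ : ℕ → ℝ) : ℝ × ℝ :=
  let n := N s θ φ
  let a := S θ φ (n - 1)
  let b := S θ φ n
  let r := (s - a.1) / (b.1 - a.1)
  (r * (b.2.1 - a.2.1) + a.2.1, r * (b.2.2 - a.2.2) + a.2.2)

/-- The opening `∂_r C` of the tube, in the coordinates `(y, z)` of its plane. -/
def opening : Set (ℝ × ℝ) :=
  {q | q.1 ^ 2 + q.2 ^ 2 ≤ 1}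

/-- The disc `D_t(y₀, z₀)` of radius `t` centred at `(1 - t) (y₀, z₀)`, for `p = (y₀, z₀)`. -/
def disc (t : ℝ) (p : ℝ × ℝ) : Set (ℝ × ℝ) :=
  {q | (q.1 - (1 - t) * p.1) ^ 2 + (q.2 - (1 - t) * p.2) ^ 2 ≤ t ^ 2}

end LambertTube

end

namespace RandomWalk

/-! The displacements of the ray along the axis are i.i.d. with the symmetric law `axialLaw`, so the
numbers S^x_k form a random walk, and O_s, U_s are its overshoot and undershoot. Let J_s = O_s + U_s
be the step which passes the level s. The disc D_t is the image of the opening under the homothety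
of ratio t centred at the last reflection point, and the next reflection point lies on the unit
circle in the (y, z)-plane. Hence Y_s ∈ D_t exactly when U_s ≤ t J_s (`exitPoint_mem_disc_iff`), and
the problem becomes one-dimensional.

Put h(s) = P(U_s ≤ t J_s). Splitting the walk at its first positive value gives h(s) = P(s ≤ t J_0 -
U_0) + E[h(s - O_0); O_0 ≤ s] (`earlyProb_renewal`), and the renewal theorem yields h(s) → E[(t J_0
- U_0)⁺] / E[O_0] (`tendsto_earlyProb`). Three facts carry this. The walk passes every level, by
symmetry and unboundedness of the steps (`ae_passage_pos`). The mean of J_0 is finite, by duality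
and the finite second moment of the steps (`lintegral_jump_lt_top`, `lintegral_axialLaw_sq_lt_top`).
Finally, `axialLaw` dominates a multiple of Lebesgue measure on every [0, L]
(`exists_smul_volume_le_axialLaw`), which forces h(s) - h(s - x) → 0 (`tendsto_sub_shift`). Then h(T
- y) may be replaced by h(T) in the integrated equation ∫₀ᵀ h(T - y) P(O_0 > y) dy = ∫₀ᵀ P(v ≤ t J_0
- U_0) dv, and the limit follows.

For (a), U_0 = 0 if the first step is positive, so the limit is at least a multiple of t, against
the area π t². For (b), E[O_0] - E[(t J_0 - U_0)⁺] is asymptotic to (1 - t) E[J_0], against the area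
π (1 - t)(1 + t). -/

lemma measure_eq_tsum_inter_fiber {β : Type*} [MeasurableSpace β] (m : Measure β) {ν : β → ℕ}
    (hν : Measurable ν) {B : Set β} (hB : MeasurableSet B) :
    m B = ∑' n, m (B ∩ ν ⁻¹' {n}) := by
  rw [← measure_iUnion]
  · rw [← inter_iUnion, ← preimage_iUnion, iUnion_of_singleton, preimage_univ, inter_univ]
  · intro i j hij
    refine Set.disjoint_left.2 fun x hx hy => hij ?_
    exact hx.2.symm.trans hy.2
  · exact fun n => hB.inter (hν (measurableSet_singleton n))

/-! ### I.i.d. sequences: concatenation, reversal, strong Markov property. -/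

section Sequences

variable {α : Type*} [MeasurableSpace α]

/-- The sequence which follows `x` for the first `n` terms and then starts on `y`. -/
def glue (n : ℕ) (x y : ℕ → α) : ℕ → α := fun k => if k < n then x k else y (k - n)

/-- The sequence whose first `n` terms are those of `x` in reverse order. -/
def rev (n : ℕ) (x : ℕ → α) : ℕ → α := fun k => if k < n then x (n - 1 - k) else x k

lemma measurable_glue (n : ℕ) : Measurable fun p : (ℕ → α) × (ℕ → α) => glue n p.1 p.2 := by
  refine measurable_pi_lambda _ fun k => ?_
  by_cases h : k < n
  · simp only [glue, h, if_true]; fun_prop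
  · simp only [glue, h, if_false]; fun_prop

lemma measurable_rev (n : ℕ) : Measurable (rev n : (ℕ → α) → ℕ → α) := by
  refine measurable_pi_lambda _ fun k => ?_
  by_cases h : k < n
  · simp only [rev, h, if_true]; fun_prop
  · simp only [rev, h, if_false]; fun_prop

/-- The law of an i.i.d. sequence. -/
noncomputable abbrev seqLaw (μ : Measure α) [IsProbabilityMeasure μ] : Measure (ℕ → α) :=
  Measure.infinitePi fun _ : ℕ => μ

variable (μ : Measure α) [IsProbabilityMeasure μ]

/-- A finite cylinder pulls back to a product of two cylinders, one on the coordinates below `n` and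
one on the shifted remaining coordinates. -/
lemma map_glue (n : ℕ) :
    ((seqLaw μ).prod (seqLaw μ)).map (fun p => glue n p.1 p.2) = seqLaw μ := by
  refine Measure.eq_infinitePi _ fun s t ht => ?_
  rw [Measure.map_apply (measurable_glue n) (MeasurableSet.pi s.countable_toSet fun i _ => ht i)]
  have hset : (fun p : (ℕ → α) × (ℕ → α) => glue n p.1 p.2) ⁻¹' (Set.pi s t) =
      (Set.pi (s.filter (· < n) : Finset ℕ) t) ×ˢ
        (Set.pi ((s.filter fun k => ¬ k < n).image (· - n) : Finset ℕ) fun k => t (k + n)) := by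
    ext ⟨x, y⟩
    simp only [mem_preimage, Set.mem_pi, mem_prod, Finset.coe_filter, Finset.coe_image,
      Set.mem_image, mem_ofPred_eq, glue, Finset.mem_coe]
    constructor
    · intro h
      refine ⟨fun i hi => by simpa [hi.2] using h i hi.1, ?_⟩
      rintro _ ⟨i, hi, rfl⟩
      have := h i hi.1
      rw [if_neg hi.2] at this
      rwa [Nat.sub_add_cancel (not_lt.1 hi.2)]
    · rintro ⟨h1, h2⟩ i hi
      split_ifs with hn
      · exact h1 i ⟨hi, hn⟩
      · have := h2 (i - n) ⟨i, ⟨hi, hn⟩, rfl⟩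
        rwa [Nat.sub_add_cancel (not_lt.1 hn)] at this
  rw [hset, Measure.prod_prod, Measure.infinitePi_pi _ fun i _ => ht i,
    Measure.infinitePi_pi _ fun i _ => ht _, Finset.prod_image, ← Finset.prod_filter_mul_prod_filter_not s (· < n)]
  · congr 1
    refine Finset.prod_congr rfl fun i hi => ?_
    rw [Nat.sub_add_cancel (not_lt.1 (Finset.mem_filter.1 hi).2)]
  · intro a ha b hb hab
    have h1 := (Finset.mem_filter.1 ha).2
    have h2 := (Finset.mem_filter.1 hb).2
    simp only at hab
    omega

/-- Reversal permutes the coordinates by an involution `e`, so it maps cylinders to cylinders of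
equal mass. This is the source of the duality arguments below. -/
lemma map_rev (n : ℕ) : (seqLaw μ).map (rev n) = seqLaw μ := by
  refine Measure.eq_infinitePi _ fun s t ht => ?_
  rw [Measure.map_apply (measurable_rev n) (MeasurableSet.pi s.countable_toSet fun i _ => ht i)]
  set e : ℕ → ℕ := fun k => if k < n then n - 1 - k else k with he
  have hee : ∀ k, e (e k) = k := by intro k; simp only [he]; split_ifs <;> omega
  have hset : (rev n : (ℕ → α) → ℕ → α) ⁻¹' (Set.pi s t) =
      Set.pi (s.image e : Finset ℕ) fun k => t (e k) := by
    ext x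
    have hrev : ∀ k, rev n x k = x (e k) := fun k => by simp only [rev, he]; split_ifs <;> rfl
    simp only [mem_preimage, Set.mem_pi, Finset.coe_image, Set.mem_image, Finset.mem_coe, hrev]
    constructor
    · rintro h _ ⟨i, hi, rfl⟩
      rw [hee]; exact h i hi
    · intro h i hi
      have := h (e i) ⟨i, hi, rfl⟩
      rwa [hee] at this
  rw [hset, Measure.infinitePi_pi _ fun i _ => ht _, Finset.prod_image]
  · simp only [hee]
  · intro a _ b _ hab
    rw [← hee a, ← hee b]; exact congrArg e hab

/-- The strong Markov property: restarting an i.i.d. sequence with an independent copy after a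
stopping time does not change its law. -/
lemma map_glue_stopping {ν : (ℕ → α) → ℕ} (hν : Measurable ν)
    (hglue : ∀ n x y, 0 < n → (ν (glue n x y) = n ↔ ν x = n))
    (hpos : ∀ᵐ x ∂seqLaw μ, 0 < ν x) :
    ((seqLaw μ).prod (seqLaw μ)).map (fun p => glue (ν p.1) p.1 p.2) = seqLaw μ := by
  have hm : Measurable fun p : (ℕ → α) × (ℕ → α) => glue (ν p.1) p.1 p.2 := by
    have : Measurable fun q : ((ℕ → α) × (ℕ → α)) × ℕ => glue q.2 q.1.1 q.1.2 :=
      measurable_from_prod_countable_left fun n => measurable_glue n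
    exact this.comp (measurable_id.prodMk (hν.comp measurable_fst))
  ext B hB
  rw [Measure.map_apply hm hB]
  -- On `ν = n` the random gluing is gluing at the fixed time `n`, and by `hglue` this event can be
  -- read off the glued sequence.
  have key : ∀ n, 0 < n → ((seqLaw μ).prod (seqLaw μ))
      ((fun p => glue (ν p.1) p.1 p.2) ⁻¹' B ∩ (fun p => ν p.1) ⁻¹' {n}) =
      seqLaw μ (B ∩ ν ⁻¹' {n}) := by
    intro n hn
    conv_rhs => rw [← map_glue μ n,
      Measure.map_apply (measurable_glue n) (hB.inter (hν (measurableSet_singleton n)))]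
    congr 1
    ext ⟨x, y⟩
    simp only [mem_inter_iff, mem_preimage, mem_singleton_iff, hglue n x y hn]
    constructor
    · rintro ⟨h1, h2⟩; rw [h2] at h1; exact ⟨h1, h2⟩
    · rintro ⟨h1, h2⟩; rw [← h2] at h1; exact ⟨by rwa [h2] at h1 ⊢, h2⟩
  -- The value `0` stands for a time which never comes; `hglue` says nothing about it, so it has to
  -- be null.
  have h0 : seqLaw μ (ν ⁻¹' {0}) = 0 := by
    refine measure_mono_null (fun x hx => ?_) (ae_iff.1 hpos)
    have : ν x = 0 := hx
    simp [this]
  have h0' : ((seqLaw μ).prod (seqLaw μ)) ((fun p => ν p.1) ⁻¹' {0}) = 0 := by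
    have : (fun p : (ℕ → α) × (ℕ → α) => ν p.1) ⁻¹' {0} = (ν ⁻¹' {0}) ×ˢ univ := by
      ext; simp
    rw [this, Measure.prod_prod, h0, zero_mul]
  rw [measure_eq_tsum_inter_fiber _ (hν.comp measurable_fst) (hm hB),
    measure_eq_tsum_inter_fiber _ hν hB]
  refine tsum_congr fun n => ?_
  rcases Nat.eq_zero_or_pos n with rfl | hn
  · rw [measure_mono_null inter_subset_right h0]
    exact measure_mono_null inter_subset_right h0'
  · exact key n hn

end Sequences
-- Partial sums, first passage, overshoot and undershoot.
/-- The partial sums of a sequence. -/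
def walk (x : ℕ → ℝ) (n : ℕ) : ℝ := ∑ k ∈ Finset.range n, x k

/-- The first positive time at which the partial sums exceed `s`, and `0` if there is none. -/
noncomputable def passage (s : ℝ) (x : ℕ → ℝ) : ℕ := sInf {n : ℕ | 0 < n ∧ s < walk x n}

@[simp] lemma walk_zero (x : ℕ → ℝ) : walk x 0 = 0 := by simp [walk]

lemma walk_succ (x : ℕ → ℝ) (n : ℕ) : walk x (n + 1) = walk x n + x n :=
  Finset.sum_range_succ _ _

@[simp] lemma walk_one (x : ℕ → ℝ) : walk x 1 = x 0 := by simp [walk]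

lemma walk_neg (x : ℕ → ℝ) (n : ℕ) : walk (fun k => -x k) n = -walk x n := by simp [walk]

lemma walk_glue_of_le {n k : ℕ} (h : k ≤ n) (x y : ℕ → ℝ) : walk (glue n x y) k = walk x k := by
  refine Finset.sum_congr rfl fun i hi => ?_
  simp [glue, (Finset.mem_range.1 hi).trans_le h]

lemma walk_glue_add (n k : ℕ) (x y : ℕ → ℝ) :
    walk (glue n x y) (n + k) = walk x n + walk y k := by
  rw [walk, Finset.sum_range_add]
  congr 1
  · exact walk_glue_of_le le_rfl x y
  · exact Finset.sum_congr rfl fun i _ => by simp [glue]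

lemma walk_rev_of_le {n k : ℕ} (h : k ≤ n) (x : ℕ → ℝ) :
    walk (rev n x) k = walk x n - walk x (n - k) := by
  induction k with
  | zero => simp
  | succ k ih =>
    rw [walk_succ, ih (by omega)]
    have h1 : n - k = (n - (k + 1)) + 1 := by omega
    have h2 : n - 1 - k = n - (k + 1) := by omega
    rw [h1, walk_succ]
    simp only [rev, h2, show k < n from h, if_true]
    ring

@[fun_prop]
lemma measurable_walk (n : ℕ) : Measurable fun x : ℕ → ℝ => walk x n := by
  unfold walk; fun_prop

lemma passage_pos_iff {s : ℝ} {x : ℕ → ℝ} : 0 < passage s x ↔ ∃ n, 0 < n ∧ s < walk x n := by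
  constructor
  · intro h; exact Nat.nonempty_of_pos_sInf h
  · intro h; exact (Nat.sInf_mem (s := {n : ℕ | 0 < n ∧ s < walk x n}) h).1

lemma lt_walk_passage {s : ℝ} {x : ℕ → ℝ} (h : 0 < passage s x) : s < walk x (passage s x) :=
  (Nat.sInf_mem (s := {n : ℕ | 0 < n ∧ s < walk x n}) (Nat.nonempty_of_pos_sInf h)).2

lemma walk_le_of_lt_passage {s : ℝ} {x : ℕ → ℝ} {k : ℕ} (hk : 0 < k) (h : k < passage s x) :
    walk x k ≤ s := by
  by_contra hlt
  exact Nat.notMem_of_lt_sInf h ⟨hk, not_le.1 hlt⟩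

lemma passage_eq_iff {s : ℝ} {x : ℕ → ℝ} {n : ℕ} (hn : 0 < n) :
    passage s x = n ↔ s < walk x n ∧ ∀ k, 0 < k → k < n → walk x k ≤ s := by
  constructor
  · rintro rfl
    exact ⟨lt_walk_passage hn, fun k => walk_le_of_lt_passage⟩
  · rintro ⟨h1, h2⟩
    refine le_antisymm (Nat.sInf_le ⟨hn, h1⟩) (not_lt.1 fun hlt => ?_)
    have hp : 0 < passage s x := passage_pos_iff.2 ⟨n, hn, h1⟩
    exact absurd (lt_walk_passage hp) (not_lt.2 (h2 _ hp hlt))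

lemma passage_eq_zero_iff {s : ℝ} {x : ℕ → ℝ} :
    passage s x = 0 ↔ ∀ k, 0 < k → walk x k ≤ s := by
  rw [← not_iff_not, ← ne_eq, ← Nat.pos_iff_ne_zero, passage_pos_iff]
  push Not
  rfl

lemma passage_glue_eq_iff (s : ℝ) (n : ℕ) (x y : ℕ → ℝ) (hn : 0 < n) :
    passage s (glue n x y) = n ↔ passage s x = n := by
  rw [passage_eq_iff hn, passage_eq_iff hn, walk_glue_of_le le_rfl]
  refine and_congr Iff.rfl (forall_congr' fun k => forall_congr' fun _ => forall_congr' fun hk => ?_)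
  rw [walk_glue_of_le hk.le]

lemma passage_glue_of_le {s : ℝ} {n : ℕ} {x y : ℕ → ℝ} (h : ∀ k, 0 < k → k ≤ n → walk x k ≤ s)
    (hy : 0 < passage (s - walk x n) y) :
    passage s (glue n x y) = n + passage (s - walk x n) y := by
  rw [passage_eq_iff (by omega), walk_glue_add]
  refine ⟨by linarith [lt_walk_passage hy], fun k hk hlt => ?_⟩
  rcases le_or_gt k n with hkn | hkn
  · rw [walk_glue_of_le hkn]; exact h k hk hkn
  · obtain ⟨j, rfl⟩ := Nat.exists_eq_add_of_lt hkn
    rw [add_assoc, walk_glue_add]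
    have := walk_le_of_lt_passage (s := s - walk x n) (x := y) (k := j + 1) (by omega) (by omega)
    linarith

/-- Measurability is joint in the level and the sequence because the renewal argument integrates
over levels. -/
lemma measurable_passage : Measurable fun p : ℝ × (ℕ → ℝ) => passage p.1 p.2 := by
  refine measurable_to_countable' fun n => ?_
  have hlt : ∀ k, MeasurableSet {p : ℝ × (ℕ → ℝ) | p.1 < walk p.2 k} := fun k =>
    measurableSet_lt measurable_fst ((measurable_walk k).comp measurable_snd)
  have hle : ∀ k, MeasurableSet {p : ℝ × (ℕ → ℝ) | walk p.2 k ≤ p.1} := fun k =>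
    measurableSet_le ((measurable_walk k).comp measurable_snd) measurable_fst
  rcases Nat.eq_zero_or_pos n with rfl | hn
  · have : (fun p : ℝ × (ℕ → ℝ) => passage p.1 p.2) ⁻¹' {0} =
        ⋂ k, ⋂ (_ : 0 < k), {p : ℝ × (ℕ → ℝ) | walk p.2 k ≤ p.1} := by
      ext p; simp [passage_eq_zero_iff]
    rw [this]
    exact MeasurableSet.iInter fun k => MeasurableSet.iInter fun _ => hle k
  · have : (fun p : ℝ × (ℕ → ℝ) => passage p.1 p.2) ⁻¹' {n} =
        {p : ℝ × (ℕ → ℝ) | p.1 < walk p.2 n} ∩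
        ⋂ k, ⋂ (_ : 0 < k), ⋂ (_ : k < n), {p : ℝ × (ℕ → ℝ) | walk p.2 k ≤ p.1} := by
      ext p; simp [passage_eq_iff hn]
    rw [this]
    exact (hlt n).inter (MeasurableSet.iInter fun k => MeasurableSet.iInter fun _ =>
      MeasurableSet.iInter fun _ => hle k)

/-- The overshoot of the level `s`. -/
noncomputable def overshoot (s : ℝ) (x : ℕ → ℝ) : ℝ := walk x (passage s x) - s

/-- The undershoot of the level `s`. -/
noncomputable def undershoot (s : ℝ) (x : ℕ → ℝ) : ℝ := s - walk x (passage s x - 1)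

/-- The step by which the walk passes the level `s`. -/
noncomputable def jump (s : ℝ) (x : ℕ → ℝ) : ℝ := x (passage s x - 1)

lemma measurable_comp_passage {f : ℕ → ℝ × (ℕ → ℝ) → ℝ} (hf : ∀ n, Measurable (f n)) :
    Measurable fun p : ℝ × (ℕ → ℝ) => f (passage p.1 p.2) p := by
  have : Measurable fun q : (ℝ × (ℕ → ℝ)) × ℕ => f q.2 q.1 :=
    measurable_from_prod_countable_left hf
  exact this.comp (measurable_id.prodMk measurable_passage)

lemma measurable_overshoot : Measurable fun p : ℝ × (ℕ → ℝ) => overshoot p.1 p.2 :=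
  measurable_comp_passage (f := fun n p => walk p.2 n - p.1) fun n => by fun_prop

lemma measurable_undershoot : Measurable fun p : ℝ × (ℕ → ℝ) => undershoot p.1 p.2 :=
  measurable_comp_passage (f := fun n p => p.1 - walk p.2 (n - 1)) fun n => by fun_prop

lemma measurable_jump : Measurable fun p : ℝ × (ℕ → ℝ) => jump p.1 p.2 :=
  measurable_comp_passage (f := fun n p => p.2 (n - 1)) fun n => by fun_prop

lemma overshoot_add_undershoot {s : ℝ} {x : ℕ → ℝ} (h : 0 < passage s x) :
    overshoot s x + undershoot s x = jump s x := by
  obtain ⟨n, hn⟩ : ∃ n, passage s x = n + 1 := ⟨passage s x - 1, by omega⟩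
  simp only [overshoot, undershoot, jump, hn, Nat.add_sub_cancel, walk_succ]
  ring

lemma overshoot_pos {s : ℝ} {x : ℕ → ℝ} (h : 0 < passage s x) : 0 < overshoot s x :=
  sub_pos.2 (lt_walk_passage h)

lemma undershoot_nonneg {s : ℝ} (hs : 0 ≤ s) {x : ℕ → ℝ} (h : 0 < passage s x) : 0 ≤ undershoot s x := by
  refine sub_nonneg.2 ?_
  -- Time `0` is not among the times tested by `passage`; there the bound is `walk x 0 = 0 ≤ s`.
  rcases Nat.eq_zero_or_pos (passage s x - 1) with h0 | h0
  · rw [h0]; simpa using hs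
  · exact walk_le_of_lt_passage h0 (by omega)

lemma jump_pos {s : ℝ} (hs : 0 ≤ s) {x : ℕ → ℝ} (h : 0 < passage s x) : 0 < jump s x := by
  rw [← overshoot_add_undershoot h]
  linarith [overshoot_pos h, undershoot_nonneg hs h]

/-! ### A symmetric walk with unbounded steps passes every level. -/

section Fluctuations

variable (μ : Measure ℝ) [IsProbabilityMeasure μ]

/-- The lower bounds for probabilities all come from here: an event on an initial block and one on
an independent continuation. -/
lemma seqLaw_le_of_glue {n : ℕ} {A B C : Set (ℕ → ℝ)} (hA : MeasurableSet A)
    (h : ∀ x ∈ B, ∀ y ∈ C, glue n x y ∈ A) : seqLaw μ B * seqLaw μ C ≤ seqLaw μ A := by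
  conv_rhs => rw [← map_glue μ n, Measure.map_apply (measurable_glue n) hA]
  rw [← Measure.prod_prod]
  exact measure_mono fun p hp => h _ hp.1 _ hp.2

lemma seqLaw_eval (n : ℕ) {B : Set ℝ} (hB : MeasurableSet B) :
    seqLaw μ {x | x n ∈ B} = μ B := by
  have := Measure.infinitePi_map_eval (fun _ : ℕ => μ) n
  conv_rhs => rw [← this, Measure.map_apply (measurable_pi_apply n) hB]
  rfl

lemma seqLaw_neg (hsym : μ.map (fun y => -y) = μ) :
    (seqLaw μ).map (fun x k => -x k) = seqLaw μ := by
  rw [Measure.infinitePi_map_pi (fun _ => μ) (f := fun _ y => -y) fun _ => measurable_neg]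
  simp only [hsym]

lemma measurableSet_forall_walk {R : ℕ → (ℕ → ℝ) → Prop} (p : ℕ → Prop)
    (h : ∀ k, MeasurableSet {x | R k x}) : MeasurableSet {x : ℕ → ℝ | ∀ k, p k → R k x} := by
  have : {x : ℕ → ℝ | ∀ k, p k → R k x} = ⋂ k, ⋂ (_ : p k), {x | R k x} := by ext; simp
  rw [this]
  exact MeasurableSet.iInter fun k => MeasurableSet.iInter fun _ => h k

lemma measurableSet_forall_walk_le (s : ℝ) :
    MeasurableSet {x : ℕ → ℝ | ∀ k, 0 < k → walk x k ≤ s} :=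
  measurableSet_forall_walk _ fun k => measurableSet_le (measurable_walk k) measurable_const

/-- If the walk stayed nonpositive with probability `q > 0`, each `n` would be the first time of the
overall maximum with probability at least `μ (Iio 0) * q * q`. These events are disjoint, so their
probabilities cannot sum to infinity. -/
lemma seqLaw_forall_walk_nonpos (hsym : μ.map (fun y => -y) = μ) (hneg : μ (Iio 0) ≠ 0) :
    seqLaw μ {x | ∀ k, 0 < k → walk x k ≤ 0} = 0 := by
  set q := seqLaw μ {x | ∀ k, 0 < k → walk x k ≤ 0} with hq
  by_contra hq0
  -- Strict before `n` and weak after `n`: the first time at which the maximum is attained, hence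
  -- disjointness.
  set M : ℕ → Set (ℕ → ℝ) := fun n =>
    {x | ∀ j, j < n → walk x j < walk x n} ∩ {x | ∀ j, n < j → walk x j ≤ walk x n} with hM
  have hMm : ∀ n, MeasurableSet (M n) := fun n =>
    (measurableSet_forall_walk _ fun k => measurableSet_lt (measurable_walk k) (measurable_walk n)).inter
      (measurableSet_forall_walk _ fun k =>
        measurableSet_le (measurable_walk k) (measurable_walk n))
  have hdisj : Pairwise (Function.onFun Disjoint M) := by
    have : ∀ i j, i < j → Disjoint (M i) (M j) := fun i j hij =>
      Set.disjoint_left.2 fun x hx hy => absurd (hy.1 i hij) (not_lt.2 (hx.2 j hij))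
    intro i j hij
    rcases lt_or_gt_of_ne hij with h | h
    · exact this _ _ h
    · exact (this _ _ h).symm
  -- Reversal followed by a change of sign turns a strict record at time `n` into partial sums which
  -- are negative at the times 1, ..., n. A negative first step and a nonpositive continuation
  -- suffice.
  have ha : ∀ n, μ (Iio 0) * q ≤ seqLaw μ {x | ∀ j, j < n → walk x j < walk x n} := by
    intro n
    have hm : MeasurableSet {x : ℕ → ℝ | ∀ j, j < n → walk x j < walk x n} :=
      measurableSet_forall_walk _ fun k => measurableSet_lt (measurable_walk k) (measurable_walk n)
    rw [← seqLaw_eval μ 0 measurableSet_Iio]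
    conv_rhs => rw [← map_rev μ n, Measure.map_apply (measurable_rev n) hm, ← seqLaw_neg μ hsym,
      Measure.map_apply (by fun_prop) (measurable_rev n hm)]
    refine seqLaw_le_of_glue μ (n := 1) ?_ fun x hx y hy => ?_
    · exact (show Measurable fun (x : ℕ → ℝ) k => -x k by fun_prop) (measurable_rev n hm)
    · intro j hj
      rw [walk_rev_of_le hj.le, walk_rev_of_le le_rfl, Nat.sub_self, walk_neg, walk_neg, walk_neg]
      obtain ⟨i, hi⟩ : ∃ i, n - j = 1 + i := ⟨n - j - 1, by omega⟩
      rw [hi, walk_glue_add, walk_one, walk_zero]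
      have hx0 : x 0 < 0 := hx
      have : walk y i ≤ 0 := by
        rcases Nat.eq_zero_or_pos i with rfl | h
        · simp
        · exact hy i h
      linarith
  have hlow : ∀ n, μ (Iio 0) * q * q ≤ seqLaw μ (M n) := by
    intro n
    refine (mul_le_mul_left (ha n) q).trans (seqLaw_le_of_glue μ (n := n) (hMm n) fun x hx y hy => ?_)
    refine ⟨fun j hj => ?_, fun j hj => ?_⟩
    · rw [walk_glue_of_le hj.le, walk_glue_of_le le_rfl]; exact hx j hj
    · obtain ⟨i, rfl⟩ := Nat.exists_eq_add_of_lt hj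
      rw [add_assoc, walk_glue_add, walk_glue_of_le le_rfl]
      linarith [hy (i + 1) (by omega)]
  have hsum : ∑' _ : ℕ, μ (Iio 0) * q * q ≤ 1 :=
    calc ∑' _ : ℕ, μ (Iio 0) * q * q ≤ ∑' n, seqLaw μ (M n) := ENNReal.tsum_le_tsum hlow
      _ = seqLaw μ (⋃ n, M n) := (measure_iUnion hdisj hMm).symm
      _ ≤ 1 := prob_le_one
  rw [ENNReal.tsum_const_eq_top_of_ne_zero (mul_ne_zero (mul_ne_zero hneg hq0) hq0)] at hsum
  simp at hsum

/-- A symmetric walk with unbounded steps passes every level. -/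
lemma ae_passage_pos (hsym : μ.map (fun y => -y) = μ) (hneg : ∀ s : ℝ, μ (Iio s) ≠ 0) (s : ℝ) :
    ∀ᵐ x ∂seqLaw μ, 0 < passage s x := by
  rw [ae_iff]
  have : {x : ℕ → ℝ | ¬ 0 < passage s x} = {x | ∀ k, 0 < k → walk x k ≤ s} := by
    ext x; simp [passage_eq_zero_iff]
  rw [this]
  -- A first step below `min 0 (-s)`, followed by a walk which never exceeds `s`, gives a walk which
  -- is never positive; this has probability zero.
  have h := seqLaw_le_of_glue μ (n := 1) (A := {x | ∀ k, 0 < k → walk x k ≤ 0})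
    (B := {x | x 0 ∈ Iio (min 0 (-s))}) (C := {x | ∀ k, 0 < k → walk x k ≤ s})
    (measurableSet_forall_walk_le 0) fun x hx y hy k hk => ?_
  · rw [seqLaw_forall_walk_nonpos μ hsym (hneg 0), seqLaw_eval μ 0 measurableSet_Iio] at h
    exact (mul_eq_zero.1 (le_antisymm h bot_le)).resolve_left (hneg _)
  · obtain ⟨i, rfl⟩ : ∃ i, k = 1 + i := ⟨k - 1, by omega⟩
    have hx0 : x 0 < min 0 (-s) := hx
    rw [lt_min_iff] at hx0
    rw [walk_glue_add, walk_one]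
    rcases Nat.eq_zero_or_pos i with rfl | h
    · simpa using hx0.1.le
    · linarith [hy i h]

end Fluctuations
-- Duality, and the mean of the first jump to a positive value.
section Moments

variable (μ : Measure ℝ) [IsProbabilityMeasure μ]

lemma measurableSet_nonpos_upTo (n : ℕ) :
    MeasurableSet {x : ℕ → ℝ | ∀ k, 0 < k → k ≤ n → walk x k ≤ 0} := by
  have : {x : ℕ → ℝ | ∀ k, 0 < k → k ≤ n → walk x k ≤ 0} =
      {x | ∀ k, (0 < k ∧ k ≤ n) → walk x k ≤ 0} := by simp
  rw [this]
  exact measurableSet_forall_walk _ fun k => measurableSet_le (measurable_walk k) measurable_const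

/-- The Green measure of the walk killed on entering `(0, ∞)` is bounded on intervals of
length `1`. -/
lemma tsum_green_mul_le_one (a : ℝ) :
    (∑' n, seqLaw μ ({x | ∀ k, 0 < k → k ≤ n → walk x k ≤ 0} ∩
      {x | a ≤ -walk x n ∧ -walk x n < a + 1})) * μ (Iio (-1)) ≤ 1 := by
  -- The time reversal of the events in the sum: `n` is a weak minimum so far, with depth in `[a, a
  -- + 1)`.
  set D : ℕ → Set (ℕ → ℝ) := fun n => {x | ∀ j, j < n → walk x n ≤ walk x j} ∩
    {x | a ≤ -walk x n ∧ -walk x n < a + 1} with hD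
  have hDm : ∀ n, MeasurableSet (D n) := fun n =>
    (measurableSet_forall_walk _ fun k => measurableSet_le (measurable_walk n) (measurable_walk k)).inter
      ((measurableSet_le measurable_const (measurable_walk n).neg).inter
        (measurableSet_lt (measurable_walk n).neg measurable_const))
  have hle : ∀ n, seqLaw μ ({x | ∀ k, 0 < k → k ≤ n → walk x k ≤ 0} ∩
      {x | a ≤ -walk x n ∧ -walk x n < a + 1}) ≤ seqLaw μ (D n) := by
    intro n
    conv_rhs => rw [← map_rev μ n, Measure.map_apply (measurable_rev n) (hDm n)]
    refine measure_mono fun x hx => ⟨fun j hj => ?_, ?_⟩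
    · rw [walk_rev_of_le le_rfl, walk_rev_of_le hj.le, Nat.sub_self, walk_zero]
      linarith [hx.1 (n - j) (by omega) (by omega)]
    · simpa [walk_rev_of_le le_rfl] using hx.2
  -- A further step below `-1` takes the walk below the strip of width `1`, and later minima stay
  -- below it. So at most one `n` qualifies.
  set A : ℕ → Set (ℕ → ℝ) := fun n => D n ∩ {x | x n < -1} with hA
  have hAm : ∀ n, MeasurableSet (A n) := fun n =>
    (hDm n).inter (measurableSet_lt (measurable_pi_apply n) measurable_const)
  have hdisj : Pairwise (Function.onFun Disjoint A) := by
    have : ∀ i j, i < j → Disjoint (A i) (A j) := by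
      intro i j hij
      refine Set.disjoint_left.2 fun x hx hy => ?_
      have h1 : walk x j ≤ walk x (i + 1) := by
        rcases eq_or_lt_of_le (show i + 1 ≤ j from hij) with h | h
        · rw [h]
        · exact hy.1.1 _ h
      rw [walk_succ] at h1
      have h2 : x i < -1 := hx.2
      have h3 := hx.1.2.1
      have h4 := hy.1.2.2
      linarith
    intro i j hij
    rcases lt_or_gt_of_ne hij with h | h
    · exact this _ _ h
    · exact (this _ _ h).symm
  have hprod : ∀ n, seqLaw μ (D n) * μ (Iio (-1)) ≤ seqLaw μ (A n) := by
    intro n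
    rw [← seqLaw_eval μ 0 measurableSet_Iio]
    refine seqLaw_le_of_glue μ (n := n) (hAm n) fun x hx y hy => ⟨⟨fun j hj => ?_, ?_⟩, ?_⟩
    · rw [walk_glue_of_le le_rfl, walk_glue_of_le hj.le]; exact hx.1 j hj
    · simpa [walk_glue_of_le le_rfl] using hx.2
    · simpa [glue] using hy
  rw [← ENNReal.tsum_mul_right]
  calc _ ≤ ∑' n, seqLaw μ (A n) :=
        ENNReal.tsum_le_tsum fun n => (mul_le_mul_left (hle n) _).trans (hprod n)
    _ = seqLaw μ (⋃ n, A n) := (measure_iUnion hdisj hAm).symm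
    _ ≤ 1 := prob_le_one

lemma lintegral_seqLaw_glue (n : ℕ) {f : (ℕ → ℝ) → ENNReal} (hf : Measurable f) :
    ∫⁻ x, f x ∂seqLaw μ = ∫⁻ x, ∫⁻ y, f (glue n x y) ∂seqLaw μ ∂seqLaw μ := by
  conv_lhs => rw [← map_glue μ n, lintegral_map hf (measurable_glue n)]
  exact lintegral_prod _ (hf.comp (measurable_glue n)).aemeasurable

lemma lintegral_seqLaw_eval (n : ℕ) {f : ℝ → ENNReal} (hf : Measurable f) :
    ∫⁻ x, f (x n) ∂seqLaw μ = ∫⁻ y, f y ∂μ := by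
  conv_rhs => rw [← Measure.infinitePi_map_eval (fun _ : ℕ => μ) n,
    lintegral_map hf (measurable_pi_apply n)]

/-- After exchanging sum and integral, a value `y > 0` is counted once for each `k < y`, so it
contributes `⌈y⌉₊ * y ≤ 2 * y ^ 2 + 1`. -/
lemma tsum_lintegral_tail_lt_top (hm2 : ∫⁻ y, ENNReal.ofReal (y ^ 2) ∂μ < ⊤) :
    ∑' k : ℕ, ∫⁻ y in Ioi (k : ℝ), ENNReal.ofReal y ∂μ < ⊤ := by
  have h1 : ∀ k : ℕ, ∫⁻ y in Ioi (k : ℝ), ENNReal.ofReal y ∂μ =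
      ∫⁻ y, (Ioi (k : ℝ)).indicator (fun y => ENNReal.ofReal y) y ∂μ := fun k =>
    (lintegral_indicator measurableSet_Ioi _).symm
  simp_rw [h1]
  rw [← lintegral_tsum fun k =>
    (ENNReal.measurable_ofReal.indicator measurableSet_Ioi).aemeasurable]
  have h2 : ∀ y : ℝ, ∑' k : ℕ, (Ioi (k : ℝ)).indicator (fun y => ENNReal.ofReal y) y ≤
      2 * ENNReal.ofReal (y ^ 2) + 1 := by
    intro y
    rcases le_or_gt y 0 with hy | hy
    · have : ∀ k : ℕ, (Ioi (k : ℝ)).indicator (fun y => ENNReal.ofReal y) y = 0 := fun k =>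
        indicator_of_notMem (fun h : (k : ℝ) < y => by
          have := Nat.cast_nonneg (α := ℝ) k; linarith) _
      simp [this]
    · rw [tsum_eq_sum (s := Finset.range ⌈y⌉₊)]
      · calc _ ≤ ∑ k ∈ Finset.range ⌈y⌉₊, ENNReal.ofReal y :=
            Finset.sum_le_sum fun k _ => indicator_le_self' (fun _ _ => bot_le) _
          _ = ENNReal.ofReal (⌈y⌉₊ * y) := by
            rw [Finset.sum_const, Finset.card_range, nsmul_eq_mul, ENNReal.ofReal_mul (by positivity),
              ENNReal.ofReal_natCast]
          _ ≤ ENNReal.ofReal (2 * y ^ 2 + 1) :=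
            ENNReal.ofReal_le_ofReal (by nlinarith [Nat.ceil_lt_add_one hy.le, sq_nonneg (y - 1)])
          _ = _ := by
            rw [ENNReal.ofReal_add (by positivity) zero_le_one, ENNReal.ofReal_mul zero_le_two]; simp
      · intro k hk
        refine indicator_of_notMem (fun h : (k : ℝ) < y => hk ?_) _
        rw [Finset.mem_range]
        exact_mod_cast h.trans_le (Nat.le_ceil y)
  refine (lintegral_mono h2).trans_lt ?_
  rw [lintegral_add_right _ measurable_const, lintegral_const_mul _ (by fun_prop)]
  simp [ENNReal.mul_lt_top_iff, hm2]

/-- The step by which the walk becomes positive has a finite expectation if the steps have a finite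
second moment. -/
lemma lintegral_jump_lt_top (hneg : μ (Iio (-1)) ≠ 0)
    (hm2 : ∫⁻ y, ENNReal.ofReal (y ^ 2) ∂μ < ⊤) (hpos : ∀ᵐ x ∂seqLaw μ, 0 < passage 0 x) :
    ∫⁻ x, ENNReal.ofReal (jump 0 x) ∂seqLaw μ < ⊤ := by
  set B : ℕ → Set (ℕ → ℝ) := fun n => {x | ∀ k, 0 < k → k ≤ n → walk x k ≤ 0} with hB
  have hBm : ∀ n, MeasurableSet (B n) := measurableSet_nonpos_upTo
  set r : ℝ → ENNReal := fun v => ∫⁻ y in Ioi v, ENNReal.ofReal y ∂μ with hr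
  -- The first passage of `0` occurs with step `n`: no positive value up to time `n`, then a step
  -- larger than the depth.
  set f : ℕ → (ℕ → ℝ) → ENNReal := fun n =>
    (B n ∩ {x | -walk x n < x n}).indicator fun x => ENNReal.ofReal (x n) with hf
  have hfm : ∀ n, Measurable (f n) := fun n =>
    Measurable.indicator (by fun_prop) ((hBm n).inter
      (measurableSet_lt (measurable_walk n).neg (measurable_pi_apply n)))
  set F : ℕ → ℕ → Set (ℕ → ℝ) := fun n k => B n ∩ {x | (k : ℝ) ≤ -walk x n ∧ -walk x n < k + 1}
  have hFm : ∀ n k, MeasurableSet (F n k) := fun n k => (hBm n).inter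
    ((measurableSet_le measurable_const (measurable_walk n).neg).inter
        (measurableSet_lt (measurable_walk n).neg measurable_const))
  have h1 : ∫⁻ x, ENNReal.ofReal (jump 0 x) ∂seqLaw μ ≤ ∑' n, ∫⁻ x, f n x ∂seqLaw μ := by
    rw [← lintegral_tsum fun n => (hfm n).aemeasurable]
    refine lintegral_mono_ae (hpos.mono fun x hx => ?_)
    refine le_trans (le_of_eq ?_) (ENNReal.le_tsum (passage 0 x - 1))
    have hmem : x ∈ B (passage 0 x - 1) ∩ {x' | -walk x' (passage 0 x - 1) < x' (passage 0 x - 1)} := by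
      refine ⟨fun k hk hkn => walk_le_of_lt_passage hk (by omega), ?_⟩
      have h := lt_walk_passage hx
      have h' : passage 0 x = passage 0 x - 1 + 1 := by omega
      rw [h', walk_succ] at h
      show -walk x (passage 0 x - 1) < x (passage 0 x - 1)
      linarith
    exact (indicator_of_mem hmem fun x => ENNReal.ofReal (x (passage 0 _ - 1))).symm
  -- At depth in `[k, k + 1)` the passing step exceeds `k` and is independent of the past, so its
  -- mean contribution is at most `r k`.
  have h2 : ∀ n, ∫⁻ x, f n x ∂seqLaw μ ≤ ∑' k : ℕ, seqLaw μ (F n k) * r k := by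
    intro n
    rw [lintegral_seqLaw_glue μ n (hfm n)]
    have hx : ∀ x, ∫⁻ y, f n (glue n x y) ∂seqLaw μ ≤
        ∑' k : ℕ, (F n k).indicator (fun _ => r k) x := by
      intro x
      by_cases hxB : x ∈ B n
      · have hw : walk x n ≤ 0 := by
          rcases Nat.eq_zero_or_pos n with rfl | h
          · simp
          · exact hxB n h le_rfl
        have hxF : x ∈ F n ⌊-walk x n⌋₊ :=
          ⟨hxB, Nat.floor_le (by linarith), Nat.lt_floor_add_one _⟩
        refine le_trans ?_ (ENNReal.le_tsum ⌊-walk x n⌋₊)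
        rw [indicator_of_mem hxF, hr]
        simp only
        rw [← lintegral_indicator measurableSet_Ioi, ← lintegral_seqLaw_eval μ 0
          (ENNReal.measurable_ofReal.indicator measurableSet_Ioi)]
        refine lintegral_mono fun y => ?_
        have hyn : glue n x y n = y 0 := by simp [glue]
        by_cases hy : -walk x n < y 0
        · have hmem : y 0 ∈ Ioi ((⌊-walk x n⌋₊ : ℕ) : ℝ) := hxF.2.1.trans_lt hy
          rw [indicator_of_mem hmem, ← hyn]
          exact indicator_le_self _ _ _
        · refine le_trans (le_of_eq (indicator_of_notMem (fun h => hy ?_) _)) bot_le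
          have : -walk (glue n x y) n < glue n x y n := h.2
          rwa [walk_glue_of_le le_rfl, hyn] at this
      · have : ∀ y, f n (glue n x y) = 0 := fun y =>
          indicator_of_notMem (fun h => hxB fun k hk hkn => by
            have := h.1 k hk hkn
            rwa [walk_glue_of_le hkn] at this) _
        simp [this]
    refine (lintegral_mono hx).trans (le_of_eq ?_)
    rw [lintegral_tsum fun k => (measurable_const.indicator (hFm n k)).aemeasurable]
    refine tsum_congr fun k => ?_
    rw [lintegral_indicator_const (hFm n k), mul_comm]
  refine h1.trans_lt ((ENNReal.tsum_le_tsum h2).trans_lt ?_)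
  -- Summing over `n` first leaves the Green measure of a unit interval, which is bounded uniformly
  -- in `k`.
  rw [ENNReal.tsum_comm]
  simp_rw [ENNReal.tsum_mul_right]
  refine lt_of_le_of_lt (ENNReal.tsum_le_tsum (g := fun k : ℕ => (μ (Iio (-1)))⁻¹ * r k)
    fun k => mul_le_mul_left ?_ _) ?_
  · rw [ENNReal.le_inv_iff_mul_le]
    exact tsum_green_mul_le_one μ k
  · rw [ENNReal.tsum_mul_left]
    exact ENNReal.mul_lt_top (ENNReal.inv_lt_top.2 (pos_iff_ne_zero.2 hneg))
      (tsum_lintegral_tail_lt_top μ hm2)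

end Moments
-- Asymptotic translation invariance of asymptotically harmonic functions.
section Shift

variable {μ : Measure ℝ} [IsProbabilityMeasure μ]

/-- The integral telescopes to two end intervals of length `x`, so the bound does not grow with `L`.
-/
lemma integral_sub_shift_le {h : ℝ → ℝ} (hm : Measurable h) (hb : ∀ s, |h s| ≤ 1) {x : ℝ}
    (hx : 0 ≤ x) (L s : ℝ) :
    ∫ y in (0 : ℝ)..L, (h (s - y) - h (s - y - x)) ≤ 2 * x := by
  have hi : ∀ a b, IntervalIntegrable h volume a b := fun a b => by
    refine (intervalIntegrable_const (c := (1 : ℝ))).mono_fun hm.aestronglyMeasurable ?_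
    exact ae_of_all _ fun s => by simpa using hb s
  have hle : ∀ a, |∫ y in (a - x)..a, h y| ≤ x := fun a => by
    have := intervalIntegral.norm_integral_le_of_norm_le_const (a := a - x) (b := a) (f := h)
      (C := 1) fun y _ => hb y
    simpa [abs_of_nonneg hx] using this
  have e1 : ∫ y in (0 : ℝ)..L, h (s - y) = ∫ y in (s - L)..s, h y := by
    rw [intervalIntegral.integral_comp_sub_left (fun y => h y) s, sub_zero]
  have e2 : ∫ y in (0 : ℝ)..L, h (s - y - x) = ∫ y in (s - L - x)..(s - x), h y := by
    have : ∀ y, s - y - x = (s - x) - y := fun y => by ring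
    simp_rw [this]
    rw [intervalIntegral.integral_comp_sub_left (fun y => h y) (s - x), sub_zero,
      show s - x - L = s - L - x by ring]
  have hi1 : IntervalIntegrable (fun y => h (s - y)) volume 0 L := by
    refine (intervalIntegrable_const (c := (1 : ℝ))).mono_fun (Measurable.aestronglyMeasurable (by fun_prop)) ?_
    exact ae_of_all _ fun y => by simpa using hb _
  have hi2 : IntervalIntegrable (fun y => h (s - y - x)) volume 0 L := by
    refine (intervalIntegrable_const (c := (1 : ℝ))).mono_fun (Measurable.aestronglyMeasurable (by fun_prop)) ?_
    exact ae_of_all _ fun y => by simpa using hb _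
  rw [intervalIntegral.integral_sub hi1 hi2, e1, e2]
  have a1 := intervalIntegral.integral_add_adjacent_intervals (hi (s - L - x) (s - x)) (hi (s - x) s)
  have a2 := intervalIntegral.integral_add_adjacent_intervals (hi (s - L - x) (s - L)) (hi (s - L) s)
  have b1 := abs_le.1 (hle s)
  have b2 := abs_le.1 (hle (s - L))
  linarith [b1.2, b2.1]

lemma tendsto_measureReal_Ioi_atTop : Tendsto (fun s => μ.real (Ioi s)) atTop (𝓝 0) := by
  have h1 : ∀ s, μ.real (Ioi s) = 1 - cdf μ s := fun s => by
    rw [cdf_eq_real, ← compl_Iic, probReal_compl_eq_one_sub measurableSet_Iic]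
  simp_rw [h1]
  simpa using (tendsto_const_nhds (x := (1 : ℝ))).sub (tendsto_cdf_atTop μ)

/-- Bounded functions which are asymptotically harmonic for a walk with a spread-out step law
are asymptotically invariant under translations, one inequality. -/
lemma eventually_sub_shift_le
    (hdom : ∀ L : ℝ, 0 < L → ∃ c : ℝ, 0 < c ∧
      ENNReal.ofReal c • volume.restrict (Icc 0 L) ≤ μ)
    {h : ℝ → ℝ} (hm : Measurable h) (hb : ∀ s, |h s| ≤ 1)
    (hh : Tendsto (fun s => h s - ∫ y, h (s - y) ∂μ) atTop (𝓝 0)) {x : ℝ} (hx : 0 ≤ x)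
    {ε : ℝ} (hε : 0 < ε) : ∀ᶠ s in atTop, h s - h (s - x) < ε := by
  set d : ℝ → ℝ := fun s => h s - h (s - x) with hd
  -- The aim is that the limsup `D` of `d` is at most `0`. Where `d s` is near `D`, the average of
  -- `d (s - y)` over `μ` is also near `D`, while `d` hardly exceeds `D` far out; so `d (s - y)` is
  -- near `D` on average over `[0, L]`. Telescoping then gives `L * D ≤ 2 * x` for every `L`.
  have hdm : Measurable d := by fun_prop
  have hdb : ∀ s, -2 ≤ d s ∧ d s ≤ 2 := fun s => by
    have h1 := abs_le.1 (hb s)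
    have h2 := abs_le.1 (hb (s - x))
    constructor <;> simp only [hd] <;> linarith [h1.1, h1.2, h2.1, h2.2]
  have hbd : IsBoundedUnder (· ≤ ·) atTop d := isBoundedUnder_of ⟨2, fun s => (hdb s).2⟩
  have hcb : IsCoboundedUnder (· ≤ ·) atTop d :=
    (isBoundedUnder_of ⟨-2, fun s => (hdb s).1⟩ : IsBoundedUnder (· ≥ ·) atTop d).isCoboundedUnder_le
  set D := limsup d atTop with hD
  suffices hD0 : D ≤ 0 from eventually_lt_of_limsup_lt (hD0.trans_lt hε) hbd
  have hDlow : -2 ≤ D := le_limsup_of_le hbd fun b hb' => by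
    obtain ⟨s, hs⟩ := hb'.exists
    exact (hdb s).1.trans hs
  have hdint : ∀ s (m : Measure ℝ) [IsFiniteMeasure m], Integrable (fun y => d (s - y)) m := by
    intro s m _
    refine Integrable.of_bound (C := 2) (Measurable.aestronglyMeasurable (by fun_prop)) (ae_of_all _ fun y => ?_)
    exact abs_le.2 (hdb _)
  have hdh : Tendsto (fun s => d s - ∫ y, d (s - y) ∂μ) atTop (𝓝 0) := by
    have hhint : ∀ s, Integrable (fun y => h (s - y)) μ := fun s =>
      Integrable.of_bound (C := 1) (Measurable.aestronglyMeasurable (by fun_prop)) (ae_of_all _ fun y => hb _)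
    have hshift : Tendsto (fun s : ℝ => s - x) atTop atTop := tendsto_atTop_add_const_right _ _ tendsto_id
    have := hh.sub (hh.comp hshift)
    rw [sub_zero] at this
    refine this.congr fun s => ?_
    have e : ∀ y, d (s - y) = h (s - y) - h (s - x - y) := fun y => by
      simp only [hd]; rw [show s - y - x = s - x - y by ring]
    simp_rw [e]
    rw [integral_sub (hhint _) (hhint _)]
    simp only [hd, Function.comp]
    ring
  have htail := tendsto_measureReal_Ioi_atTop (μ := μ)
  -- the bound for windows of length `L`
  have hL : ∀ L : ℝ, 0 < L → L * D ≤ 2 * x := by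
    intro L hLpos
    obtain ⟨c, hc, hcμ⟩ := hdom L hLpos
    suffices hδ : ∀ δ : ℝ, 0 < δ → c * (L * D - 2 * x) ≤ 0 + δ by
      have := le_of_forall_pos_le_add hδ
      nlinarith
    intro δ hδ
    -- Seven: in the integral of `e` below, `ε'` enters once from the definition of `e`, once from
    -- `d s > D - ε'`, once from `hdh`, and four times from the tail.
    set ε' := δ / 7 with hε'
    have hε'pos : 0 < ε' := by positivity
    obtain ⟨s₀, hs₀⟩ := eventually_atTop.1
      (eventually_lt_of_limsup_lt (show limsup d atTop < D + ε' by linarith) hbd)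
    have hfreq := frequently_lt_of_lt_limsup hcb (show D - ε' < limsup d atTop by linarith)
    have hshift : Tendsto (fun s : ℝ => s - s₀) atTop atTop :=
      tendsto_atTop_add_const_right _ _ tendsto_id
    obtain ⟨s, hs1, hs2, hs3⟩ := (hfreq.and_eventually
      ((hdh.eventually (gt_mem_nhds hε'pos)).and
        ((htail.comp hshift).eventually (gt_mem_nhds hε'pos)))).exists
    simp only [Function.comp] at hs3
    -- The defect below `D + ε'`. For `y > s - s₀` the bound on `d` is not available; as `D ≥ -2`
    -- and `d ≤ 2`, adding `4` there keeps `e` nonnegative.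
    set e : ℝ → ℝ := fun y => D + ε' - d (s - y) + (Ioi (s - s₀)).indicator (fun _ => 4) y with he
    have hind : ∀ m : Measure ℝ, IsFiniteMeasure m →
        Integrable ((Ioi (s - s₀)).indicator fun _ => (4 : ℝ)) m := fun m _ =>
      (integrable_const _).indicator measurableSet_Ioi
    have heint : ∀ (m : Measure ℝ) [IsFiniteMeasure m], Integrable e m := fun m _ =>
      ((integrable_const _).sub (hdint s m)).add (hind m inferInstance)
    have hepos : ∀ y, 0 ≤ e y := by
      intro y
      simp only [he]
      by_cases hy : s - s₀ < y
      · rw [indicator_of_mem (show y ∈ Ioi (s - s₀) from hy)]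
        linarith [(hdb (s - y)).2]
      · rw [indicator_of_notMem (show y ∉ Ioi (s - s₀) from hy)]
        linarith [hs₀ (s - y) (by linarith)]
    have hI1 : ∫ y, e y ∂μ = D + ε' - ∫ y, d (s - y) ∂μ + 4 * μ.real (Ioi (s - s₀)) := by
      have hsub : Integrable (fun y => D + ε' - d (s - y)) μ := (integrable_const _).sub (hdint s μ)
      simp only [he]
      rw [integral_add hsub (hind μ inferInstance),
        integral_sub (integrable_const _) (hdint s μ), integral_indicator_const _ measurableSet_Ioi]
      simp [mul_comm]
    have hI2 : c * ∫ y in Icc 0 L, e y ≤ ∫ y, e y ∂μ := by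
      have := integral_mono_measure hcμ (ae_of_all _ hepos) (heint μ)
      rwa [integral_smul_measure, ENNReal.toReal_ofReal hc.le, smul_eq_mul] at this
    have hI3 : L * (D + ε') - 2 * x ≤ ∫ y in Icc 0 L, e y := by
      have h1 : ∫ y in Icc 0 L, (D + ε' - d (s - y)) ≤ ∫ y in Icc 0 L, e y := by
        refine integral_mono ((integrable_const _).sub (hdint s _)) (heint _) fun y => ?_
        simp only [he]
        linarith [indicator_nonneg (s := Ioi (s - s₀)) (f := fun _ => (4 : ℝ)) (fun _ _ => by norm_num) y]
      rw [integral_sub (integrable_const _) (hdint s _), integral_const] at h1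
      have h2 := integral_sub_shift_le hm hb hx L s
      rw [intervalIntegral.integral_of_le hLpos.le, ← integral_Icc_eq_integral_Ioc] at h2
      simp only [measureReal_restrict_apply_univ, volume_real_Icc_of_le hLpos.le, sub_zero,
        smul_eq_mul] at h1
      simp only [hd] at h1
      linarith
    have h4 := mul_le_mul_of_nonneg_left hI3 hc.le
    have h5 : 0 ≤ c * (L * ε') := by positivity
    have h6 : c * (L * (D + ε') - 2 * x) = c * (L * D - 2 * x) + c * (L * ε') := by ring
    linarith
  by_contra hcon
  have hpos := not_le.1 hcon
  have := hL ((2 * x + 1) / D) (by positivity)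
  rw [div_mul_cancel₀ _ hpos.ne'] at this
  linarith

/-- The one-sided bound is applied to `h` and to `-h`. -/
lemma tendsto_sub_shift
    (hdom : ∀ L : ℝ, 0 < L → ∃ c : ℝ, 0 < c ∧
      ENNReal.ofReal c • volume.restrict (Icc 0 L) ≤ μ)
    {h : ℝ → ℝ} (hm : Measurable h) (hb : ∀ s, |h s| ≤ 1)
    (hh : Tendsto (fun s => h s - ∫ y, h (s - y) ∂μ) atTop (𝓝 0)) {x : ℝ} (hx : 0 ≤ x) :
    Tendsto (fun s => h s - h (s - x)) atTop (𝓝 0) := by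
  rw [Metric.tendsto_nhds]
  intro ε hε
  have hh' : Tendsto (fun s => -h s - ∫ y, -h (s - y) ∂μ) atTop (𝓝 0) := by
    have := hh.neg
    rw [neg_zero] at this
    refine this.congr fun s => ?_
    rw [integral_neg]; ring
  filter_upwards [eventually_sub_shift_le hdom hm hb hh hx hε,
    eventually_sub_shift_le hdom hm.neg (fun s => by simpa using hb s) hh' hx hε] with s h1 h2
  simp only [Pi.neg_apply] at h2
  rw [Real.dist_eq, sub_zero, abs_lt]
  constructor <;> linarith

end Shift
-- The renewal equation and the renewal theorem.
section Renewal

lemma undershoot_glue_of_le {s : ℝ} {n : ℕ} {x y : ℕ → ℝ} (h : ∀ k, 0 < k → k ≤ n → walk x k ≤ s)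
    (hy : 0 < passage (s - walk x n) y) :
    undershoot s (glue n x y) = undershoot (s - walk x n) y := by
  rw [undershoot, undershoot, passage_glue_of_le h hy, Nat.add_sub_assoc hy, walk_glue_add]
  ring

lemma jump_glue_of_le {s : ℝ} {n : ℕ} {x y : ℕ → ℝ} (h : ∀ k, 0 < k → k ≤ n → walk x k ≤ s)
    (hy : 0 < passage (s - walk x n) y) :
    jump s (glue n x y) = jump (s - walk x n) y := by
  rw [jump, jump, passage_glue_of_le h hy, Nat.add_sub_assoc hy]
  simp [glue]

lemma passage_glue_of_lt {s : ℝ} (hs : 0 ≤ s) {x : ℕ → ℝ} (hx : 0 < passage 0 x)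
    (h : s < overshoot 0 x) (y : ℕ → ℝ) : passage s (glue (passage 0 x) x y) = passage 0 x := by
  rw [passage_eq_iff hx, walk_glue_of_le le_rfl]
  refine ⟨by simpa [overshoot] using h, fun k hk hlt => ?_⟩
  rw [walk_glue_of_le hlt.le]
  exact (walk_le_of_lt_passage hk hlt).trans hs

lemma undershoot_glue_of_lt {s : ℝ} (hs : 0 ≤ s) {x : ℕ → ℝ} (hx : 0 < passage 0 x)
    (h : s < overshoot 0 x) (y : ℕ → ℝ) :
    undershoot s (glue (passage 0 x) x y) = s + undershoot 0 x := by
  rw [undershoot, undershoot, passage_glue_of_lt hs hx h, walk_glue_of_le (Nat.sub_le _ _)]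
  ring

lemma jump_glue_of_lt {s : ℝ} (hs : 0 ≤ s) {x : ℕ → ℝ} (hx : 0 < passage 0 x)
    (h : s < overshoot 0 x) (y : ℕ → ℝ) : jump s (glue (passage 0 x) x y) = jump 0 x := by
  rw [jump, jump, passage_glue_of_lt hs hx h, glue, if_pos (by omega)]

lemma measurable_overshoot_level (s : ℝ) : Measurable (overshoot s) :=
  measurable_overshoot.comp measurable_prodMk_left

lemma measurable_undershoot_level (s : ℝ) : Measurable (undershoot s) :=
  measurable_undershoot.comp measurable_prodMk_left

lemma measurable_jump_level (s : ℝ) : Measurable (jump s) :=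
  measurable_jump.comp measurable_prodMk_left

/-- The set of the sequences for which, at the passage of `s`, the level divides the last step in a
ratio of at most `t`. -/
def earlySet (t s : ℝ) : Set (ℕ → ℝ) := {x | undershoot s x ≤ t * jump s x}

lemma measurableSet_earlySet_prod (t : ℝ) :
    MeasurableSet {p : ℝ × (ℕ → ℝ) | p.2 ∈ earlySet t p.1} :=
  measurableSet_le measurable_undershoot (measurable_jump.const_mul t)

lemma measurableSet_earlySet (t s : ℝ) : MeasurableSet (earlySet t s) :=
  (measurable_prodMk_left (x := s)) (measurableSet_earlySet_prod t)

variable (μ : Measure ℝ) [IsProbabilityMeasure μ]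

/-- The probability of `earlySet t s`. -/
noncomputable def earlyProb (t s : ℝ) : ℝ := (seqLaw μ).real (earlySet t s)

lemma measurable_earlyProb (t : ℝ) : Measurable (earlyProb μ t) :=
  (measurable_measure_prodMk_left (ν := seqLaw μ) (measurableSet_earlySet_prod t)).ennreal_toReal

lemma earlyProb_nonneg (t s : ℝ) : 0 ≤ earlyProb μ t s := measureReal_nonneg

lemma earlyProb_le_one (t s : ℝ) : earlyProb μ t s ≤ 1 := measureReal_le_one

lemma abs_earlyProb_le_one (t s : ℝ) : |earlyProb μ t s| ≤ 1 := by
  rw [abs_of_nonneg (earlyProb_nonneg μ t s)]; exact earlyProb_le_one μ t s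

lemma measureReal_eq_integral_of_map {α β γ : Type*} [MeasurableSpace α] [MeasurableSpace β]
    [MeasurableSpace γ] {m₁ : Measure α} {m₂ : Measure β} {m : Measure γ} [IsProbabilityMeasure m₁]
    [IsProbabilityMeasure m₂] {g : α × β → γ} (hg : Measurable g) (hmap : (m₁.prod m₂).map g = m)
    {E : Set γ} (hE : MeasurableSet E) : m.real E = ∫ x, m₂.real {y | g (x, y) ∈ E} ∂m₁ := by
  rw [measureReal_def, ← hmap, Measure.map_apply hg hE, Measure.prod_apply (hg hE)]
  refine (integral_toReal ?_ ?_).symm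
  · exact (measurable_measure_prodMk_left (hg hE)).aemeasurable
  · exact ae_of_all _ fun x => measure_lt_top _ _

variable {μ}

lemma real_glue_mem_earlySet {t s : ℝ} {n : ℕ} {x : ℕ → ℝ}
    (hpos : ∀ s : ℝ, ∀ᵐ x ∂seqLaw μ, 0 < passage s x)
    (h : ∀ k, 0 < k → k ≤ n → walk x k ≤ s) :
    (seqLaw μ).real {y | glue n x y ∈ earlySet t s} = earlyProb μ t (s - walk x n) := by
  refine measureReal_congr ?_
  filter_upwards [hpos (s - walk x n)] with y hy
  refine propext ?_
  show undershoot s (glue n x y) ≤ t * jump s (glue n x y) ↔ _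
  rw [undershoot_glue_of_le h hy, jump_glue_of_le h hy]
  rfl

lemma integral_seqLaw_eval {f : ℝ → ℝ} (hf : Measurable f) (n : ℕ) :
    ∫ x, f (x n) ∂seqLaw μ = ∫ y, f y ∂μ := by
  conv_rhs => rw [← Measure.infinitePi_map_eval (fun _ : ℕ => μ) n,
    integral_map (measurable_pi_apply n).aemeasurable hf.aestronglyMeasurable]

/-- Conditioning on the first step of the walk itself, not on the first ladder height, since it is
the step law that dominates Lebesgue measure. The equation is exact unless the first step already
exceeds `s`, an event of vanishing probability. -/
lemma tendsto_earlyProb_sub_integral (hpos : ∀ s : ℝ, ∀ᵐ x ∂seqLaw μ, 0 < passage s x) (t : ℝ) :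
    Tendsto (fun s => earlyProb μ t s - ∫ y, earlyProb μ t (s - y) ∂μ) atTop (𝓝 0) := by
  refine squeeze_zero_norm (fun s => ?_) (tendsto_measureReal_Ioi_atTop (μ := μ))
  have hm : Measurable fun y => earlyProb μ t (s - y) :=
    (measurable_earlyProb μ t).comp (measurable_const.sub measurable_id)
  set a : (ℕ → ℝ) → ℝ := fun x => (seqLaw μ).real {y | glue 1 x y ∈ earlySet t s} with ha
  have ham : Measurable a := (measurable_measure_prodMk_left (ν := seqLaw μ)
    (measurable_glue 1 (measurableSet_earlySet t s))).ennreal_toReal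
  have e1 : earlyProb μ t s = ∫ x, a x ∂seqLaw μ :=
    measureReal_eq_integral_of_map (measurable_glue 1) (map_glue μ 1) (measurableSet_earlySet t s)
  have hai : Integrable a (seqLaw μ) :=
    Integrable.of_bound (C := 1) ham.aestronglyMeasurable (ae_of_all _ fun x => by
      rw [norm_of_nonneg measureReal_nonneg]; exact measureReal_le_one)
  have hbi : Integrable (fun x : ℕ → ℝ => earlyProb μ t (s - x 0)) (seqLaw μ) :=
    Integrable.of_bound (C := 1) (hm.comp (measurable_pi_apply 0)).aestronglyMeasurable
      (ae_of_all _ fun x => abs_earlyProb_le_one μ t _)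
  rw [e1, ← integral_seqLaw_eval hm 0, ← integral_sub hai hbi]
  have hset : MeasurableSet {x : ℕ → ℝ | x 0 ∈ Ioi s} := measurable_pi_apply 0 measurableSet_Ioi
  refine (norm_integral_le_of_norm_le (g := {x : ℕ → ℝ | x 0 ∈ Ioi s}.indicator fun _ => (1 : ℝ))
    ((integrable_const _).indicator hset) (ae_of_all _ fun x => ?_)).trans ?_
  · by_cases hx : s < x 0
    · rw [indicator_of_mem (show x ∈ {x : ℕ → ℝ | x 0 ∈ Ioi s} from hx), norm_eq_abs, abs_le]
      have h1 := earlyProb_nonneg μ t (s - x 0)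
      have h2 := earlyProb_le_one μ t (s - x 0)
      have h3 : 0 ≤ a x := measureReal_nonneg
      have h4 : a x ≤ 1 := measureReal_le_one
      constructor <;> linarith
    · rw [indicator_of_notMem (show x ∉ {x : ℕ → ℝ | x 0 ∈ Ioi s} from hx)]
      have : a x = earlyProb μ t (s - x 0) := by
        have := real_glue_mem_earlySet (t := t) (s := s) (n := 1) (x := x) hpos fun k hk hk1 => by
          obtain rfl : k = 1 := by omega
          rw [walk_one]; exact not_lt.1 hx
        rwa [walk_one] at this
      rw [this, sub_self, norm_zero]
  · rw [integral_indicator_const _ hset, smul_eq_mul, mul_one, measureReal_def, seqLaw_eval μ 0 measurableSet_Ioi]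
    rfl

/-- The renewal equation at the first ladder epoch. -/
lemma earlyProb_renewal (hpos : ∀ s : ℝ, ∀ᵐ x ∂seqLaw μ, 0 < passage s x) {t : ℝ} (ht : t < 1)
    {s : ℝ} (hs : 0 ≤ s) :
    earlyProb μ t s = (seqLaw μ).real {x | s ≤ t * jump 0 x - undershoot 0 x} +
      ∫ x, {x | overshoot 0 x ≤ s}.indicator (fun x => earlyProb μ t (s - overshoot 0 x)) x
        ∂seqLaw μ := by
  have hp0 : Measurable fun x : ℕ → ℝ => passage 0 x := measurable_passage.comp measurable_prodMk_left
  have ho0 := measurable_overshoot_level 0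
  have hj0 := measurable_jump_level 0
  have hu0 := measurable_undershoot_level 0
  have hgm : Measurable fun p : (ℕ → ℝ) × (ℕ → ℝ) => glue (passage 0 p.1) p.1 p.2 := by
    have : Measurable fun q : ((ℕ → ℝ) × (ℕ → ℝ)) × ℕ => glue q.2 q.1.1 q.1.2 :=
      measurable_from_prod_countable_left fun n => measurable_glue n
    exact this.comp (measurable_id.prodMk (hp0.comp measurable_fst))
  have hset : MeasurableSet {x : ℕ → ℝ | s ≤ t * jump 0 x - undershoot 0 x} :=
    measurableSet_le measurable_const ((hj0.const_mul t).sub hu0)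
  have hset' : MeasurableSet {x : ℕ → ℝ | overshoot 0 x ≤ s} := measurableSet_le ho0 measurable_const
  rw [earlyProb, measureReal_eq_integral_of_map hgm (map_glue_stopping μ hp0
    (fun n x y hn => passage_glue_eq_iff 0 n x y hn) (hpos 0)) (measurableSet_earlySet t s)]
  rw [← integral_indicator_one hset, ← integral_add]
  · refine integral_congr_ae ((hpos 0).mono fun x hx => ?_)
    have hou := overshoot_add_undershoot hx
    have hjp := jump_pos le_rfl hx
    have hw : walk x (passage 0 x) = overshoot 0 x := by simp [overshoot]
    simp only
    by_cases h : overshoot 0 x ≤ s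
    -- Here the first term vanishes: `t < 1` and a positive jump give `t * jump - undershoot <
    -- overshoot ≤ s`.
    · rw [indicator_of_mem (show x ∈ {x | overshoot 0 x ≤ s} from h),
        indicator_of_notMem (show x ∉ {x | s ≤ t * jump 0 x - undershoot 0 x} from fun h' => by
          have h'' : s ≤ t * jump 0 x - undershoot 0 x := h'
          nlinarith), zero_add, ← hw]
      refine real_glue_mem_earlySet hpos fun k hk hkn => ?_
      rcases eq_or_lt_of_le hkn with rfl | hlt
      · rwa [hw]
      · exact (walk_le_of_lt_passage hk hlt).trans hs
    · rw [indicator_of_notMem (show x ∉ {x | overshoot 0 x ≤ s} from h), add_zero]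
      have h' := not_le.1 h
      have hiff : ∀ y, glue (passage 0 x) x y ∈ earlySet t s ↔ s ≤ t * jump 0 x - undershoot 0 x := by
        intro y
        show undershoot s _ ≤ t * jump s _ ↔ _
        rw [undershoot_glue_of_lt hs hx h', jump_glue_of_lt hs hx h', le_sub_iff_add_le]
      simp_rw [hiff]
      by_cases hz : s ≤ t * jump 0 x - undershoot 0 x
      · rw [indicator_of_mem (show x ∈ {x | s ≤ t * jump 0 x - undershoot 0 x} from hz)]
        simp [hz]
      · rw [indicator_of_notMem (show x ∉ {x | s ≤ t * jump 0 x - undershoot 0 x} from hz)]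
        simp [hz]
  · exact (integrable_const (1 : ℝ)).indicator hset
  · refine Integrable.indicator ?_ hset'
    exact Integrable.of_bound (C := 1) ((measurable_earlyProb μ t).comp
      (measurable_const.sub ho0)).aestronglyMeasurable (ae_of_all _ fun x => abs_earlyProb_le_one μ t _)

lemma integral_renewal_translate {h : ℝ → ℝ} {T o : ℝ} (ho : 0 ≤ o) :
    ∫ v in Icc 0 T, (Ici o).indicator (fun v => h (v - o)) v =
      ∫ w in Icc 0 T, (Iic (T - o)).indicator h w := by
  rw [← integral_indicator measurableSet_Icc, ← integral_indicator measurableSet_Icc,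
    ← integral_sub_right_eq_self ((Icc 0 T).indicator ((Iic (T - o)).indicator h)) o]
  congr 1
  ext v
  simp only [indicator_apply, mem_Icc, mem_Ici, mem_Iic]
  split_ifs <;> first | rfl | (exfalso; grind)

/-- The renewal equation, integrated over `[0, T]`. -/
lemma integral_earlyProb_mul (hpos : ∀ s : ℝ, ∀ᵐ x ∂seqLaw μ, 0 < passage s x) {t : ℝ} (ht : t < 1)
    {T : ℝ} (hT : 0 ≤ T) :
    ∫ y in Icc 0 T, earlyProb μ t (T - y) * (seqLaw μ).real {x | y < overshoot 0 x} =
      ∫ v in Icc 0 T, (seqLaw μ).real {x | v ≤ t * jump 0 x - undershoot 0 x} := by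
  have ho0 := measurable_overshoot_level 0
  set h := earlyProb μ t with hh
  have hm : Measurable h := measurable_earlyProb μ t
  have hb : ∀ s, |h s| ≤ 1 := abs_earlyProb_le_one μ t
  set F : ℝ → (ℕ → ℝ) → ℝ := fun v x =>
    {x | overshoot 0 x ≤ v}.indicator (fun x => h (v - overshoot 0 x)) x with hF
  have hFm : Measurable fun p : ℝ × (ℕ → ℝ) => F p.1 p.2 := by
    have : (fun p : ℝ × (ℕ → ℝ) => F p.1 p.2) =
        {p : ℝ × (ℕ → ℝ) | overshoot 0 p.2 ≤ p.1}.indicator fun p => h (p.1 - overshoot 0 p.2) := by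
      ext p; simp [hF, indicator_apply]
    rw [this]
    exact Measurable.indicator (hm.comp (measurable_fst.sub (ho0.comp measurable_snd)))
      (measurableSet_le (ho0.comp measurable_snd) measurable_fst)
  have hFb : ∀ v x, ‖F v x‖ ≤ 1 := fun v x =>
    (norm_indicator_le_norm_self _ _).trans (hb _)
  have hFi : Integrable (fun p : ℝ × (ℕ → ℝ) => F p.1 p.2) ((volume.restrict (Icc 0 T)).prod (seqLaw μ)) :=
    Integrable.of_bound (C := 1) hFm.aestronglyMeasurable (ae_of_all _ fun p => hFb _ _)
  set G : ℝ → (ℕ → ℝ) → ℝ := fun w x => (Iic (T - overshoot 0 x)).indicator h w with hG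
  have hGm : Measurable fun p : ℝ × (ℕ → ℝ) => G p.1 p.2 := by
    have : (fun p : ℝ × (ℕ → ℝ) => G p.1 p.2) =
        {p : ℝ × (ℕ → ℝ) | p.1 ≤ T - overshoot 0 p.2}.indicator fun p => h p.1 := by
      ext p; simp [hG, indicator_apply]
    rw [this]
    exact Measurable.indicator (hm.comp measurable_fst)
      (measurableSet_le measurable_fst (measurable_const.sub (ho0.comp measurable_snd)))
  have hGi : Integrable (fun p : ℝ × (ℕ → ℝ) => G p.1 p.2) ((volume.restrict (Icc 0 T)).prod (seqLaw μ)) :=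
    Integrable.of_bound (C := 1) hGm.aestronglyMeasurable (ae_of_all _ fun p =>
      (norm_indicator_le_norm_self _ _).trans (hb _))
  have hmeas : Measurable fun v => (seqLaw μ).real {x | v ≤ t * jump 0 x - undershoot 0 x} := by
    have : Antitone fun v => (seqLaw μ).real {x | v ≤ t * jump 0 x - undershoot 0 x} :=
      fun a b hab => measureReal_mono fun x (hx : b ≤ _) => hab.trans hx
    exact this.measurable
  have hmeas' : Measurable fun v => (seqLaw μ).real {x | v < overshoot 0 x} := by
    have : Antitone fun v => (seqLaw μ).real {x | v < overshoot 0 x} :=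
      fun a b hab => measureReal_mono fun x (hx : b < _) => hab.trans_lt hx
    exact this.measurable
  have hgi : Integrable (fun v => (seqLaw μ).real {x | v ≤ t * jump 0 x - undershoot 0 x})
      (volume.restrict (Icc 0 T)) :=
    Integrable.of_bound (C := 1) hmeas.aestronglyMeasurable (ae_of_all _ fun v => by
      rw [norm_of_nonneg measureReal_nonneg]; exact measureReal_le_one)
  have hhi : Integrable h (volume.restrict (Icc 0 T)) :=
    Integrable.of_bound (C := 1) hm.aestronglyMeasurable (ae_of_all _ hb)
  -- integrate the renewal equation and exchange the integrals
  have e1 : ∫ v in Icc 0 T, h v =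
      (∫ v in Icc 0 T, (seqLaw μ).real {x | v ≤ t * jump 0 x - undershoot 0 x}) +
        ∫ v in Icc 0 T, ∫ x, F v x ∂seqLaw μ := by
    rw [← integral_add hgi hFi.integral_prod_left]
    exact setIntegral_congr_fun measurableSet_Icc fun v hv => earlyProb_renewal hpos ht hv.1
  have e2 : ∫ v in Icc 0 T, ∫ x, F v x ∂seqLaw μ = ∫ w in Icc 0 T, ∫ x, G w x ∂seqLaw μ := by
    refine (integral_integral_swap hFi).trans (Eq.trans ?_ (integral_integral_swap hGi).symm)
    refine integral_congr_ae ((hpos 0).mono fun x hx => ?_)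
    simp only
    rw [hG, ← integral_renewal_translate (overshoot_pos hx).le]
    refine integral_congr_ae (ae_of_all _ fun v => ?_)
    simp [hF, indicator_apply]
  -- Subtracting the part with overshoot at most `T - w` leaves the tail of the overshoot as weight.
  have e3 : ∀ w, h w - ∫ x, G w x ∂seqLaw μ =
      h w * (seqLaw μ).real {x | T - w < overshoot 0 x} := by
    intro w
    have hs : MeasurableSet {x : ℕ → ℝ | T - w < overshoot 0 x} := measurableSet_lt measurable_const ho0
    have : ∀ x, G w x = {x | T - w < overshoot 0 x}ᶜ.indicator (fun _ => h w) x := fun x => by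
      simp only [hG, indicator_apply, mem_Iic, mem_compl_iff, mem_ofPred_eq, not_lt]
      congr 1
      exact propext ⟨fun h => by linarith, fun h => by linarith⟩
    simp_rw [this]
    rw [integral_indicator_const _ hs.compl, probReal_compl_eq_one_sub hs, smul_eq_mul]
    ring
  have e4 : ∫ y in Icc 0 T, h (T - y) * (seqLaw μ).real {x | y < overshoot 0 x} =
      ∫ w in Icc 0 T, h w * (seqLaw μ).real {x | T - w < overshoot 0 x} := by
    rw [integral_Icc_eq_integral_Ioc, integral_Icc_eq_integral_Ioc,
      ← intervalIntegral.integral_of_le hT, ← intervalIntegral.integral_of_le hT]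
    have := intervalIntegral.integral_comp_sub_left (a := 0) (b := T)
      (fun w => h w * (seqLaw μ).real {x | T - w < overshoot 0 x}) T
    simpa using this
  rw [e4]
  simp_rw [← e3]
  rw [integral_sub hhi hGi.integral_prod_left, e1, e2]
  ring

lemma integral_overshoot_pos (hpos : ∀ᵐ x ∂seqLaw μ, 0 < passage 0 x)
    (hO : Integrable (overshoot 0) (seqLaw μ)) : 0 < ∫ x, overshoot 0 x ∂seqLaw μ := by
  rw [integral_pos_iff_support_of_nonneg_ae (hpos.mono fun x hx => (overshoot_pos hx).le) hO]
  have : Function.support (overshoot 0) =ᵐ[seqLaw μ] univ := by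
    rw [eventuallyEq_univ]
    exact hpos.mono fun x hx => (overshoot_pos hx).ne'
  rw [measure_congr this]; simp

lemma max_sub_undershoot_le {t : ℝ} (ht : t < 1) {x : ℕ → ℝ} (hx : 0 < passage 0 x) :
    max (t * jump 0 x - undershoot 0 x) 0 ≤ overshoot 0 x := by
  have h1 := overshoot_add_undershoot hx
  have h2 := jump_pos le_rfl hx
  exact max_le (by nlinarith) (overshoot_pos hx).le

lemma integrable_max_sub_undershoot (hpos : ∀ᵐ x ∂seqLaw μ, 0 < passage 0 x)
    (hO : Integrable (overshoot 0) (seqLaw μ)) {t : ℝ} (ht : t < 1) :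
    Integrable (fun x => max (t * jump 0 x - undershoot 0 x) 0) (seqLaw μ) := by
  refine hO.mono ((((measurable_jump_level 0).const_mul t).sub
    (measurable_undershoot_level 0)).max measurable_const).aestronglyMeasurable
      (hpos.mono fun x hx => ?_)
  rw [norm_of_nonneg (le_max_right _ _), norm_of_nonneg (overshoot_pos hx).le]
  exact max_sub_undershoot_le ht hx

/-- The renewal theorem for the position of a large level within the step which passes it. -/
theorem tendsto_earlyProb (hpos : ∀ s : ℝ, ∀ᵐ x ∂seqLaw μ, 0 < passage s x)
    (hdom : ∀ L : ℝ, 0 < L → ∃ c : ℝ, 0 < c ∧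
      ENNReal.ofReal c • volume.restrict (Icc 0 L) ≤ μ)
    (hO : Integrable (overshoot 0) (seqLaw μ)) {t : ℝ} (ht : t < 1) :
    Tendsto (earlyProb μ t) atTop (𝓝 ((∫ x, max (t * jump 0 x - undershoot 0 x) 0 ∂seqLaw μ) /
      ∫ x, overshoot 0 x ∂seqLaw μ)) := by
  set m : ℝ → ℝ := fun y => (seqLaw μ).real {x | y < overshoot 0 x} with hm
  set g : ℝ → ℝ := fun v => (seqLaw μ).real {x | v ≤ t * jump 0 x - undershoot 0 x} with hg
  set h := earlyProb μ t with hh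
  have hO0 : 0 ≤ᵐ[seqLaw μ] overshoot 0 := (hpos 0).mono fun x hx => (overshoot_pos hx).le
  have hOpos := integral_overshoot_pos (hpos 0) hO
  have hZle : ∀ᵐ x ∂seqLaw μ, t * jump 0 x - undershoot 0 x ≤ overshoot 0 x :=
    (hpos 0).mono fun x hx => (le_max_left _ _).trans (max_sub_undershoot_le ht hx)
  have hZ := integrable_max_sub_undershoot (hpos 0) hO ht
  -- The layer-cake formula gives the integral of `m` the positive value of the mean overshoot;
  -- without integrability it would be `0` by convention.
  have hmint : IntegrableOn m (Ioi 0) := by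
    by_contra hcon
    have := hO.integral_eq_integral_meas_lt hO0
    rw [integral_undef hcon] at this
    exact hOpos.ne' this
  have hme : ∫ y in Ioi 0, m y = ∫ x, overshoot 0 x ∂seqLaw μ :=
    (hO.integral_eq_integral_meas_lt hO0).symm
  have hge : ∫ v in Ioi 0, g v = ∫ x, max (t * jump 0 x - undershoot 0 x) 0 ∂seqLaw μ := by
    rw [hZ.integral_eq_integral_meas_le (ae_of_all _ fun x => le_max_right _ _)]
    refine setIntegral_congr_fun measurableSet_Ioi fun v hv => ?_
    have hv' : ¬ v ≤ 0 := not_le.2 hv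
    simp [hg, hv']
  have hgm : Measurable g :=
    (show Antitone g from fun a b hab => measureReal_mono fun x (hx : b ≤ _) => hab.trans hx).measurable
  have hgint : IntegrableOn g (Ioi 0) := by
    have hmg : IntegrableOn (fun v => (seqLaw μ).real {x | v ≤ overshoot 0 x}) (Ioi 0) := by
      by_contra hcon
      have := hO.integral_eq_integral_meas_le hO0
      rw [integral_undef hcon] at this
      exact hOpos.ne' this
    refine hmg.mono' hgm.aestronglyMeasurable (ae_of_all _ fun v => ?_)
    rw [norm_of_nonneg measureReal_nonneg]
    refine ENNReal.toReal_mono (measure_ne_top _ _) (measure_mono_ae ?_)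
    exact hZle.mono fun x hx (hv : v ≤ _) => hv.trans hx
  have hshift : ∀ y, 0 ≤ y → Tendsto (fun s => h s - h (s - y)) atTop (𝓝 0) := fun y hy =>
    tendsto_sub_shift hdom (measurable_earlyProb μ t) (abs_earlyProb_le_one μ t)
      (tendsto_earlyProb_sub_integral hpos t) hy
  -- The error made on replacing `h (T - y)` by `h T` in the integrated equation, with all `y > T`
  -- included. It is dominated by `2 * m` and tends to `0` pointwise.
  set K : ℝ → ℝ → ℝ := fun T y => (h T - (Iic T).indicator (fun y => h (T - y)) y) * m y with hK
  have hlim : Tendsto (fun T => ∫ y in Ioi 0, K T y) atTop (𝓝 (∫ _ in Ioi (0 : ℝ), (0 : ℝ))) := by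
    refine tendsto_integral_filter_of_dominated_convergence (fun y => 2 * m y)
      (Eventually.of_forall fun T => ?_) (Eventually.of_forall fun T => ae_of_all _ fun y => ?_)
      (hmint.const_mul 2) ((ae_restrict_iff' measurableSet_Ioi).2 (ae_of_all _ fun y hy => ?_))
    · exact (measurable_const.sub (((measurable_earlyProb μ t).comp
        (measurable_const.sub measurable_id)).indicator measurableSet_Iic)).aestronglyMeasurable.mul
          hmint.aestronglyMeasurable
    · rw [norm_mul, norm_of_nonneg (show 0 ≤ m y from measureReal_nonneg)]
      refine mul_le_mul_of_nonneg_right ?_ measureReal_nonneg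
      refine (norm_sub_le _ _).trans ?_
      have h1 : ‖h T‖ ≤ 1 := abs_earlyProb_le_one μ t T
      have h2 : ‖(Iic T).indicator (fun y => h (T - y)) y‖ ≤ 1 :=
        (norm_indicator_le_norm_self _ _).trans (abs_earlyProb_le_one μ t (T - y))
      linarith
    · have := (hshift y (le_of_lt hy)).mul_const (m y)
      rw [zero_mul] at this
      refine this.congr' ?_
      filter_upwards [eventually_ge_atTop y] with T hT
      rw [hK]
      simp only
      rw [indicator_of_mem (show y ∈ Iic T from hT)]
  have hKe : ∀ T, 0 ≤ T → ∫ y in Ioi 0, K T y =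
      h T * (∫ x, overshoot 0 x ∂seqLaw μ) - ∫ v in Ioc 0 T, g v := by
    intro T hT
    have hi2 : IntegrableOn (fun y => (Iic T).indicator (fun y => h (T - y) * m y) y) (Ioi 0) := by
      refine Integrable.indicator ?_ measurableSet_Iic
      refine Integrable.mono hmint (((measurable_earlyProb μ t).comp (measurable_const.sub
        measurable_id)).aestronglyMeasurable.mul hmint.aestronglyMeasurable) (ae_of_all _ fun y => ?_)
      rw [norm_mul]
      exact mul_le_of_le_one_left (norm_nonneg _) (abs_earlyProb_le_one μ t (T - y))
    have hsplit : ∀ y, K T y = h T * m y - (Iic T).indicator (fun y => h (T - y) * m y) y := fun y => by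
      simp only [hK, indicator_apply]
      split_ifs <;> ring
    simp_rw [hsplit]
    rw [integral_sub (hmint.const_mul _) hi2, integral_const_mul, hme,
      setIntegral_indicator measurableSet_Iic, Ioi_inter_Iic, ← integral_Icc_eq_integral_Ioc,
      ← integral_Icc_eq_integral_Ioc, integral_earlyProb_mul hpos ht hT]
  rw [integral_zero] at hlim
  have hgl : Tendsto (fun T => ∫ v in Ioc 0 T, g v) atTop
      (𝓝 (∫ x, max (t * jump 0 x - undershoot 0 x) 0 ∂seqLaw μ)) := by
    rw [← hge]
    refine (intervalIntegral_tendsto_integral_Ioi 0 hgint tendsto_id).congr' ?_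
    filter_upwards [eventually_ge_atTop 0] with T hT
    exact intervalIntegral.integral_of_le hT
  have := (hlim.add hgl).div_const (∫ x, overshoot 0 x ∂seqLaw μ)
  rw [zero_add] at this
  refine this.congr' ?_
  filter_upwards [eventually_ge_atTop 0] with T hT
  rw [hKe T hT, sub_add_cancel, mul_div_cancel_right₀ _ hOpos.ne']

end Renewal
-- The renewal limit for `t` near `0` and near `1`.
section Limits

lemma measure_Ioi_ne_zero {μ : Measure ℝ}
    (hdom : ∀ L : ℝ, 0 < L → ∃ c : ℝ, 0 < c ∧
      ENNReal.ofReal c • volume.restrict (Icc 0 L) ≤ μ) (s : ℝ) : μ (Ioi s) ≠ 0 := by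
  obtain ⟨c, hc, h⟩ := hdom (max s 0 + 1) (by positivity)
  intro h0
  have h1 := h (Ioi s)
  rw [h0, nonpos_iff_eq_zero, Measure.smul_apply, smul_eq_mul, mul_eq_zero] at h1
  rcases h1 with h1 | h1
  · exact absurd (ENNReal.ofReal_eq_zero.1 h1) (not_le.2 hc)
  · rw [Measure.restrict_apply measurableSet_Ioi] at h1
    have h2 : Ioc (max s 0) (max s 0 + 1) ⊆ Ioi s ∩ Icc 0 (max s 0 + 1) := fun y hy =>
      ⟨(le_max_left s 0).trans_lt hy.1, ((le_max_right s 0).trans_lt hy.1).le, hy.2⟩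
    have h3 := measure_mono_null h2 h1
    rw [Real.volume_Ioc] at h3
    simp at h3

lemma measure_Iio_ne_zero {μ : Measure ℝ} (hsym : μ.map (fun y => -y) = μ)
    (hdom : ∀ L : ℝ, 0 < L → ∃ c : ℝ, 0 < c ∧
      ENNReal.ofReal c • volume.restrict (Icc 0 L) ≤ μ) (s : ℝ) : μ (Iio s) ≠ 0 := by
  rw [← hsym, Measure.map_apply measurable_neg measurableSet_Iio]
  have : (fun y : ℝ => -y) ⁻¹' Iio s = Ioi (-s) := by ext; simp
  rw [this]
  exact measure_Ioi_ne_zero hdom _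

variable {μ : Measure ℝ} [IsProbabilityMeasure μ]

lemma integrable_jump (hneg : μ (Iio (-1)) ≠ 0)
    (hm2 : ∫⁻ y, ENNReal.ofReal (y ^ 2) ∂μ < ⊤) (hpos : ∀ᵐ x ∂seqLaw μ, 0 < passage 0 x) :
    Integrable (jump 0) (seqLaw μ) := by
  refine ⟨(measurable_jump_level 0).aestronglyMeasurable, ?_⟩
  rw [hasFiniteIntegral_iff_ofReal (hpos.mono fun x hx => (jump_pos le_rfl hx).le)]
  exact lintegral_jump_lt_top μ hneg hm2 hpos

lemma integrable_overshoot (hpos : ∀ᵐ x ∂seqLaw μ, 0 < passage 0 x)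
    (hJ : Integrable (jump 0) (seqLaw μ)) : Integrable (overshoot 0) (seqLaw μ) := by
  refine hJ.mono (measurable_overshoot_level 0).aestronglyMeasurable (hpos.mono fun x hx => ?_)
  rw [norm_of_nonneg (overshoot_pos hx).le, norm_of_nonneg (jump_pos le_rfl hx).le,
    ← overshoot_add_undershoot hx]
  linarith [undershoot_nonneg le_rfl hx]

/-- The walk may become positive with its first step, hence the linear lower bound. -/
lemma exists_mul_le_integral_max (hpos : ∀ᵐ x ∂seqLaw μ, 0 < passage 0 x)
    (hO : Integrable (overshoot 0) (seqLaw μ)) (hμ : μ (Ioi 0) ≠ 0) :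
    ∃ κ : ℝ, 0 < κ ∧ ∀ t ∈ Ioo (0 : ℝ) 1,
      t * κ ≤ ∫ x, max (t * jump 0 x - undershoot 0 x) 0 ∂seqLaw μ := by
  have hfirst : ∀ x : ℕ → ℝ, 0 < x 0 → overshoot 0 x = x 0 ∧ jump 0 x = x 0 ∧ undershoot 0 x = 0 := by
    intro x hx
    have hp : passage 0 x = 1 := (passage_eq_iff one_pos).2
      ⟨by simpa using hx, fun k h1 h2 => by omega⟩
    simp [overshoot, jump, undershoot, hp]
  set A : Set (ℕ → ℝ) := {x | x 0 ∈ Ioi 0} with hA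
  have hAm : MeasurableSet A := measurable_pi_apply 0 measurableSet_Ioi
  refine ⟨∫ x in A, overshoot 0 x ∂seqLaw μ, ?_, fun t ht => ?_⟩
  · rw [setIntegral_pos_iff_support_of_nonneg_ae
      (ae_restrict_of_ae (hpos.mono fun x hx => (overshoot_pos hx).le)) hO.integrableOn]
    refine pos_iff_ne_zero.2 fun h0 => hμ ?_
    rw [← seqLaw_eval μ 0 measurableSet_Ioi]
    refine measure_mono_null (fun x (hx : 0 < x 0) =>
      (⟨?_, hx⟩ : x ∈ Function.support (overshoot 0) ∩ A)) h0
    rw [Function.mem_support, (hfirst x hx).1]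
    exact ne_of_gt hx
  · rw [← integral_indicator hAm, ← integral_const_mul]
    refine integral_mono ((hO.indicator hAm).const_mul t)
      (integrable_max_sub_undershoot hpos hO ht.2) fun x => ?_
    simp only
    by_cases hx : x ∈ A
    · obtain ⟨h1, h2, h3⟩ := hfirst x hx
      rw [indicator_of_mem hx, h1, h2, h3, sub_zero]
      exact le_max_left _ _
    · rw [indicator_of_notMem hx, mul_zero]
      exact le_max_right _ _

/-- The quotient is at most `jump 0` almost surely, and equals it once `t * jump > undershoot`. That
holds for `t` near `1`, because `jump - undershoot` is the positive overshoot; dominated convergence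
applies. -/
lemma tendsto_integral_overshoot_sub_div (hpos : ∀ᵐ x ∂seqLaw μ, 0 < passage 0 x)
    (hJ : Integrable (jump 0) (seqLaw μ)) :
    Tendsto (fun t => ((∫ x, overshoot 0 x ∂seqLaw μ) -
      ∫ x, max (t * jump 0 x - undershoot 0 x) 0 ∂seqLaw μ) / (1 - t)) (𝓝[<] 1)
      (𝓝 (∫ x, jump 0 x ∂seqLaw μ)) := by
  have hO := integrable_overshoot hpos hJ
  have hlim : Tendsto (fun t : ℝ => ∫ x, (overshoot 0 x - max (t * jump 0 x - undershoot 0 x) 0) /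
      (1 - t) ∂seqLaw μ) (𝓝[<] 1) (𝓝 (∫ x, jump 0 x ∂seqLaw μ)) := by
    refine tendsto_integral_filter_of_dominated_convergence (jump 0)
      (Eventually.of_forall fun t => ?_) ?_ hJ (hpos.mono fun x hx => ?_)
    · exact (((measurable_overshoot_level 0).sub ((((measurable_jump_level 0).const_mul t).sub
        (measurable_undershoot_level 0)).max measurable_const)).div_const _).aestronglyMeasurable
    · filter_upwards [self_mem_nhdsWithin] with t ht
      have ht1 : 0 < 1 - t := sub_pos.2 ht
      refine hpos.mono fun x hx => ?_
      rw [norm_of_nonneg (div_nonneg (sub_nonneg.2 (max_sub_undershoot_le ht hx)) ht1.le),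
        div_le_iff₀ ht1]
      have h1 := overshoot_add_undershoot hx
      have h2 := le_max_left (t * jump 0 x - undershoot 0 x) 0
      linarith
    · have h1 := overshoot_add_undershoot hx
      have h2 := overshoot_pos hx
      have hc : Tendsto (fun t : ℝ => t * jump 0 x - undershoot 0 x) (𝓝[<] 1)
          (𝓝 (1 * jump 0 x - undershoot 0 x)) :=
        ((tendsto_id.mono_left nhdsWithin_le_nhds).mul_const _).sub_const _
      have hev := hc.eventually (lt_mem_nhds (show 0 < 1 * jump 0 x - undershoot 0 x by linarith))
      refine tendsto_const_nhds.congr' ?_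
      filter_upwards [hev, self_mem_nhdsWithin] with t ht ht1
      have ht1' : 0 < 1 - t := sub_pos.2 ht1
      rw [max_eq_left ht.le, eq_div_iff ht1'.ne']
      linarith
  refine hlim.congr' ?_
  filter_upwards [self_mem_nhdsWithin] with t ht
  rw [integral_div, integral_sub hO (integrable_max_sub_undershoot hpos hO ht)]

end Limits
end RandomWalk

/-! ### The law of the axial displacement and its symmetry. -/

namespace LambertTube

/-- The displacement along the axis of the tube between two consecutive reflections. -/
noncomputable def axialStep (θ φ : ℝ) : ℝ := chord θ φ * (cos φ * sin θ)

/-- The uniform law on `[-π/2, π/2]`. -/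
noncomputable def azimuthLaw : Measure ℝ := volume[|Icc (-(π / 2)) (π / 2)]

/-- The law of the axial displacement. -/
noncomputable def axialLaw : Measure ℝ :=
  (lambertLaw.prod azimuthLaw).map fun p => axialStep p.1 p.2

lemma measurable_axialStep : Measurable fun p : ℝ × ℝ => axialStep p.1 p.2 := by
  unfold axialStep chord; fun_prop

@[fun_prop]
lemma _root_.Measurable.axialStep {α : Type*} [MeasurableSpace α] {f g : α → ℝ} (hf : Measurable f)
    (hg : Measurable g) : Measurable fun a => axialStep (f a) (g a) := by
  unfold LambertTube.axialStep chord; fun_prop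

lemma axialStep_neg (θ φ : ℝ) : axialStep (-θ) φ = -axialStep θ φ := by
  simp [axialStep, chord]

instance : SFinite lambertLaw := by unfold lambertLaw; infer_instance

instance : SFinite azimuthLaw := by
  unfold azimuthLaw ProbabilityTheory.cond; infer_instance

lemma measurable_lambertDensity : Measurable fun θ : ℝ =>
    ENNReal.ofReal (if θ ∈ Ioo (-(π / 2)) (π / 2) then cos θ / 2 else 0) :=
  ENNReal.measurable_ofReal.comp
    (Measurable.ite measurableSet_Ioo (by fun_prop) measurable_const)

lemma lambertLaw_map_neg : lambertLaw.map (fun θ => -θ) = lambertLaw := by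
  ext B hB
  rw [Measure.map_apply measurable_neg hB, lambertLaw, withDensity_apply _ (measurable_neg hB),
    withDensity_apply _ hB, ← lintegral_indicator (measurable_neg hB), ← lintegral_indicator hB]
  refine (lintegral_congr fun θ => ?_).trans (lintegral_neg_eq_self (B.indicator _))
  have : -θ ∈ Ioo (-(π / 2)) (π / 2) ↔ θ ∈ Ioo (-(π / 2)) (π / 2) := by
    simp only [mem_Ioo]
    constructor <;> rintro ⟨h1, h2⟩ <;> constructor <;> linarith
  classical
  simp only [indicator_apply, mem_preimage, this, cos_neg]

lemma axialLaw_map_neg : axialLaw.map (fun y => -y) = axialLaw := by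
  have hm : Measurable fun p : ℝ × ℝ => (-p.1, p.2) := by fun_prop
  have h1 : (lambertLaw.prod azimuthLaw).map (fun p : ℝ × ℝ => (-p.1, p.2)) =
      lambertLaw.prod azimuthLaw := by
    have := Measure.map_prod_map lambertLaw azimuthLaw measurable_neg measurable_id
    rw [Measure.map_id] at this
    conv_rhs => rw [← lambertLaw_map_neg]
    exact this.symm
  rw [axialLaw, Measure.map_map measurable_neg measurable_axialStep]
  conv_rhs => rw [← h1, Measure.map_map measurable_axialStep hm]
  congr 1
  ext p
  simp [axialStep_neg]

lemma azimuthLaw_apply (B : Set ℝ) :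
    azimuthLaw B = ENNReal.ofReal π⁻¹ * volume (Icc (-(π / 2)) (π / 2) ∩ B) := by
  rw [azimuthLaw, cond_apply measurableSet_Icc, Real.volume_Icc,
    show π / 2 - -(π / 2) = π by ring, ENNReal.ofReal_inv_of_pos pi_pos]

/-! ### Finite second moment of the axial displacement. -/

section SecondMoment

/-- The factor `cos θ` comes from the density of the angle. It lowers the singularity at grazing,
nearly axial directions to a product of two integrable inverse square roots. -/
lemma axialStep_sq_mul_cos_le {θ φ : ℝ} (hc : 0 < cos θ) (hs : sin φ ≠ 0) :
    axialStep θ φ ^ 2 * cos θ ≤ 4 * ((√(cos θ))⁻¹ * (√|sin φ|)⁻¹) := by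
  set p := √(cos θ) with hp
  set q := √|sin φ| with hq
  set w := √|sin θ| with hw
  have hp0 : 0 < p := sqrt_pos.2 hc
  have hq0 : 0 < q := sqrt_pos.2 (abs_pos.2 hs)
  have hw0 : 0 ≤ w := sqrt_nonneg _
  have hp2 : cos θ = p ^ 2 := (sq_sqrt hc.le).symm
  have hq2 : sin φ ^ 2 = q ^ 4 := by
    rw [← sq_abs, show q ^ 4 = (q ^ 2) ^ 2 by ring, sq_sqrt (abs_nonneg _)]
  have hw2 : sin θ ^ 2 = w ^ 4 := by
    rw [← sq_abs, show w ^ 4 = (w ^ 2) ^ 2 by ring, sq_sqrt (abs_nonneg _)]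
  have hw1 : w ≤ 1 := sqrt_le_one.2 (abs_sin_le_one θ)
  have hD : 0 < (q ^ 4 * w ^ 4 + p ^ 4) := by positivity
  -- Both sides are homogeneous of degree 8 in `p` and `z = q * w`; the larger of the two decides.
  have key : p ^ 7 * (q * w) ≤ (q ^ 4 * w ^ 4 + p ^ 4) ^ 2 := by
    have hz : 0 ≤ q * w := by positivity
    set z := q * w with hzdef
    rw [show q ^ 4 * w ^ 4 = z ^ 4 by rw [hzdef]; ring]
    rcases le_total z p with h | h
    · calc p ^ 7 * z ≤ p ^ 7 * p := by gcongr
        _ ≤ (z ^ 4 + p ^ 4) ^ 2 := by nlinarith [pow_nonneg hz 4, pow_pos hp0 4]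
    · calc p ^ 7 * z ≤ z ^ 7 * z := by gcongr
        _ ≤ (z ^ 4 + p ^ 4) ^ 2 := by nlinarith [pow_nonneg hz 4, pow_pos hp0 4]
  have hw4 : w ^ 4 ≤ w := by
    calc w ^ 4 ≤ w ^ 1 := pow_le_pow_of_le_one hw0 hw1 (by norm_num)
      _ = w := pow_one w
  have e : axialStep θ φ ^ 2 * cos θ =
      4 * (p ^ 6 * w ^ 4 * cos φ ^ 2 / (q ^ 4 * w ^ 4 + p ^ 4) ^ 2) := by
    have hden : sin φ ^ 2 * sin θ ^ 2 + cos θ ^ 2 = q ^ 4 * w ^ 4 + p ^ 4 := by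
      rw [hq2, hw2, hp2]; ring
    rw [axialStep, chord, hden, hp2]
    rw [show (2 * p ^ 2 / (q ^ 4 * w ^ 4 + p ^ 4) * (cos φ * sin θ)) ^ 2 * p ^ 2 =
      (2 * p ^ 2 / (q ^ 4 * w ^ 4 + p ^ 4)) ^ 2 * cos φ ^ 2 * sin θ ^ 2 * p ^ 2 by ring, hw2]
    field_simp
    ring
  rw [e]
  refine mul_le_mul_of_nonneg_left ?_ (by norm_num)
  rw [← mul_inv, div_le_iff₀ (by positivity), inv_mul_eq_div, le_div_iff₀ (by positivity)]
  calc p ^ 6 * w ^ 4 * cos φ ^ 2 * (p * q) ≤ p ^ 6 * w * 1 * (p * q) := by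
        gcongr; exact cos_sq_le_one φ
    _ = p ^ 7 * (q * w) := by ring
    _ ≤ _ := key

lemma intervalIntegrable_inv_sqrt_abs (a b : ℝ) :
    IntervalIntegrable (fun x : ℝ => (√|x|)⁻¹) volume a b := by
  have h : ∀ a b : ℝ, IntervalIntegrable (fun x : ℝ => x ^ (-(1 / 2) : ℝ)) volume a b := fun a b =>
    intervalIntegral.intervalIntegrable_rpow' (by norm_num)
  have h' : ∀ a b : ℝ, IntervalIntegrable (fun x : ℝ => (-x) ^ (-(1 / 2) : ℝ)) volume a b :=
    fun a b => by
      simpa using IntervalIntegrable.comp_sub_left (h (-a) (-b)) 0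
  refine ((h a b).add (h' a b)).congr fun x _ => ?_
  -- The real power of a negative base carries a factor `cos (-π / 2) = 0`, so each of the two
  -- summands lives on one half-line.
  have hneg : ∀ y : ℝ, y < 0 → y ^ (-(1 / 2) : ℝ) = 0 := fun y hy => by
    rw [rpow_def_of_neg hy, show (-(1 / 2) : ℝ) * π = -(π / 2) by ring, cos_neg, cos_pi_div_two,
      mul_zero]
  have hpos : ∀ y : ℝ, 0 < y → y ^ (-(1 / 2) : ℝ) = (√y)⁻¹ := fun y hy => by
    rw [rpow_neg hy.le, sqrt_eq_rpow]
  rcases lt_trichotomy x 0 with hx | hx | hx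
  · rw [hneg x hx, hpos (-x) (by linarith), abs_of_neg hx, zero_add]
  · subst hx; simp
  · rw [hneg (-x) (by linarith), hpos x hx, abs_of_pos hx, add_zero]

lemma inv_sqrt_cos_le {θ : ℝ} (hθ : θ ∈ Ioo (-(π / 2)) (π / 2)) :
    (√(cos θ))⁻¹ ≤ √(π / 2) * ((√|π / 2 - θ|)⁻¹ + (√|π / 2 + θ|)⁻¹) := by
  have hd : 0 < π / 2 - |θ| := sub_pos.2 (abs_lt.2 hθ)
  have h1 : (π / 2 - |θ|) / (π / 2) ≤ cos θ := by
    rw [← cos_abs]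
    refine le_trans (le_of_eq ?_) (one_sub_mul_le_cos (abs_nonneg θ) (abs_lt.2 hθ).le)
    field_simp
  have h2 : (√(cos θ))⁻¹ ≤ √(π / 2) * (√(π / 2 - |θ|))⁻¹ := by
    calc (√(cos θ))⁻¹ ≤ (√((π / 2 - |θ|) / (π / 2)))⁻¹ := by
          gcongr
      _ = _ := by rw [sqrt_div hd.le, inv_div, div_eq_mul_inv]
  refine h2.trans (mul_le_mul_of_nonneg_left ?_ (sqrt_nonneg _))
  rcases le_total 0 θ with h | h
  · rw [abs_of_nonneg h] at hd ⊢
    rw [abs_of_pos hd]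
    exact le_add_of_nonneg_right (by positivity)
  · rw [abs_of_nonpos h] at hd ⊢
    rw [sub_neg_eq_add] at hd ⊢
    rw [abs_of_pos hd]
    exact le_add_of_nonneg_left (by positivity)

lemma inv_sqrt_abs_sin_le {φ : ℝ} (hφ : φ ∈ Icc (-(π / 2)) (π / 2)) (h0 : φ ≠ 0) :
    (√|sin φ|)⁻¹ ≤ √(π / 2) * (√|φ|)⁻¹ := by
  have h1 : |φ| / (π / 2) ≤ |sin φ| := by
    refine le_trans (le_of_eq ?_) (mul_abs_le_abs_sin (abs_le.2 hφ))
    field_simp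
  have h2 : 0 < |φ| := abs_pos.2 h0
  calc (√|sin φ|)⁻¹ ≤ (√(|φ| / (π / 2)))⁻¹ := by gcongr
    _ = _ := by rw [sqrt_div h2.le, inv_div, div_eq_mul_inv]

lemma cos_mul_lintegral_axialStep_sq_le {θ : ℝ} (hθ : θ ∈ Ioo (-(π / 2)) (π / 2)) :
    ENNReal.ofReal (cos θ / 2) * ∫⁻ φ, ENNReal.ofReal (axialStep θ φ ^ 2) ∂azimuthLaw ≤
      ENNReal.ofReal (π * ((√|π / 2 - θ|)⁻¹ + (√|π / 2 + θ|)⁻¹)) *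
        ∫⁻ φ, ENNReal.ofReal ((√|φ|)⁻¹) ∂azimuthLaw := by
  have hm : Measurable fun φ => ENNReal.ofReal (axialStep θ φ ^ 2) :=
    ((measurable_axialStep.comp measurable_prodMk_left).pow_const 2).ennreal_ofReal
  have hc : 0 < cos θ := cos_pos_of_mem_Ioo hθ
  have hA0 : 0 ≤ (√|π / 2 - θ|)⁻¹ + (√|π / 2 + θ|)⁻¹ := by positivity
  have hA := inv_sqrt_cos_le hθ
  generalize (√|π / 2 - θ|)⁻¹ + (√|π / 2 + θ|)⁻¹ = A at hA0 hA ⊢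
  have hae : ∀ᵐ φ ∂azimuthLaw, φ ∈ Icc (-(π / 2)) (π / 2) ∧ φ ≠ 0 :=
    (ae_cond_mem measurableSet_Icc).and (cond_absolutelyContinuous.ae_le (volume.ae_ne 0))
  calc ENNReal.ofReal (cos θ / 2) * ∫⁻ φ, ENNReal.ofReal (axialStep θ φ ^ 2) ∂azimuthLaw
      = ∫⁻ φ, ENNReal.ofReal (cos θ / 2) * ENNReal.ofReal (axialStep θ φ ^ 2) ∂azimuthLaw :=
        (lintegral_const_mul _ hm).symm
    _ ≤ ∫⁻ φ, ENNReal.ofReal (π * A) * ENNReal.ofReal ((√|φ|)⁻¹) ∂azimuthLaw := by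
        refine lintegral_mono_ae (hae.mono fun φ hφ => ?_)
        have hs : sin φ ≠ 0 := by
          intro h0
          have := mul_abs_le_abs_sin (abs_le.2 hφ.1)
          rw [h0, abs_zero] at this
          have h3 : 0 < 2 / π * |φ| := mul_pos (by positivity) (abs_pos.2 hφ.2)
          linarith
        rw [← ENNReal.ofReal_mul (by positivity), ← ENNReal.ofReal_mul (by positivity)]
        refine ENNReal.ofReal_le_ofReal ?_
        have h1 := axialStep_sq_mul_cos_le hc hs
        have h2 := mul_le_mul hA (inv_sqrt_abs_sin_le hφ.1 hφ.2) (by positivity) (by positivity)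
        -- The constant `π` is `4 / 2`, from the pointwise bound and the density, times `√(π / 2) ^
        -- 2`.
        rw [show √(π / 2) * A * (√(π / 2) * (√|φ|)⁻¹) = √(π / 2) ^ 2 * (A * (√|φ|)⁻¹) by ring,
          sq_sqrt (by positivity)] at h2
        linarith
    _ = _ := lintegral_const_mul _ (by fun_prop)

lemma lintegral_axialLaw_sq_lt_top : ∫⁻ y, ENNReal.ofReal (y ^ 2) ∂axialLaw < ⊤ := by
  have hm : Measurable fun p : ℝ × ℝ => ENNReal.ofReal (axialStep p.1 p.2 ^ 2) :=
    (measurable_axialStep.pow_const 2).ennreal_ofReal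
  rw [axialLaw, lintegral_map (by fun_prop) measurable_axialStep, lintegral_prod _ hm.aemeasurable,
    lambertLaw, lintegral_withDensity_eq_lintegral_mul _ measurable_lambertDensity
      hm.lintegral_prod_right']
  set A : ℝ → ℝ := fun θ => (√|π / 2 - θ|)⁻¹ + (√|π / 2 + θ|)⁻¹ with hA
  set B : ℝ → ℝ := fun φ => (√|φ|)⁻¹ with hB
  have hAi : IntegrableOn A (Ioo (-(π / 2)) (π / 2)) := by
    have h1 : IntervalIntegrable A volume (-(π / 2)) (π / 2) := by
      refine IntervalIntegrable.add ?_ ?_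
      · convert (intervalIntegrable_inv_sqrt_abs π 0).comp_sub_left (π / 2) using 1 <;> ring
      · convert (intervalIntegrable_inv_sqrt_abs 0 π).comp_add_left (π / 2) using 1 <;> ring
    exact ((intervalIntegrable_iff_integrableOn_Ioo_of_le (by linarith [pi_pos])).1 h1)
  have hBi : IntegrableOn B (Icc (-(π / 2)) (π / 2)) :=
    (intervalIntegrable_iff_integrableOn_Icc_of_le (by linarith [pi_pos])).1
      (intervalIntegrable_inv_sqrt_abs _ _)
  have hinner : ∀ θ, (fun θ => ENNReal.ofReal (if θ ∈ Ioo (-(π / 2)) (π / 2) then cos θ / 2 else 0)) θ *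
      ∫⁻ φ, ENNReal.ofReal (axialStep θ φ ^ 2) ∂azimuthLaw ≤
      (Ioo (-(π / 2)) (π / 2)).indicator (fun θ => ENNReal.ofReal (π * A θ) *
        ∫⁻ φ, ENNReal.ofReal (B φ) ∂azimuthLaw) θ := by
    intro θ
    by_cases hθ : θ ∈ Ioo (-(π / 2)) (π / 2)
    · simp only [if_pos hθ]
      rw [indicator_of_mem hθ]
      exact cos_mul_lintegral_axialStep_sq_le hθ
    · simp only [if_neg hθ, ENNReal.ofReal_zero, zero_mul]
      exact bot_le
  refine (lintegral_mono hinner).trans_lt ?_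
  rw [lintegral_indicator measurableSet_Ioo, lintegral_mul_const _ (by fun_prop)]
  refine ENNReal.mul_lt_top ?_ ?_
  · exact (hAi.const_mul π).lintegral_lt_top
  · rw [azimuthLaw, ProbabilityTheory.cond, lintegral_smul_measure]
    refine ENNReal.mul_lt_top (ENNReal.inv_lt_top.2 ?_) hBi.lintegral_lt_top
    rw [Real.volume_Icc]
    exact ENNReal.ofReal_pos.2 (by linarith [pi_pos])

end SecondMoment

/-! ### Lebesgue lower bound for the law of the axial displacement. -/

section SpreadOut

lemma axialStep_eq_tan {θ : ℝ} (h : cos θ ≠ 0) (φ : ℝ) :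
    axialStep θ φ = 2 * cos φ * (tan θ / (1 + sin φ ^ 2 * tan θ ^ 2)) := by
  have h1 : 1 + sin φ ^ 2 * tan θ ^ 2 = (sin φ ^ 2 * sin θ ^ 2 + cos θ ^ 2) / cos θ ^ 2 := by
    rw [tan_eq_sin_div_cos]; field_simp; ring
  have h2 : 0 < sin φ ^ 2 * sin θ ^ 2 + cos θ ^ 2 := by positivity
  rw [h1, axialStep, chord, tan_eq_sin_div_cos]
  field_simp

/-- The Lipschitz constant `1` is uniform in `k`, which makes the estimates below uniform in `φ`. -/
lemma abs_div_one_add_sub_le {k : ℝ} (hk : 0 ≤ k) (t u : ℝ) :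
    |t / (1 + k * t ^ 2) - u / (1 + k * u ^ 2)| ≤ |t - u| := by
  have h1 : 0 < 1 + k * t ^ 2 := by positivity
  have h2 : 0 < 1 + k * u ^ 2 := by positivity
  have e : t / (1 + k * t ^ 2) - u / (1 + k * u ^ 2) =
      (t - u) * ((1 - k * t * u) / ((1 + k * t ^ 2) * (1 + k * u ^ 2))) := by
    field_simp; ring
  rw [e, abs_mul]
  refine mul_le_of_le_one_right (abs_nonneg _) ?_
  rw [abs_div, abs_of_pos (mul_pos h1 h2), div_le_one (mul_pos h1 h2), abs_le]
  have h3 : 0 ≤ k * (t - u) ^ 2 := by positivity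
  have h4 : 0 ≤ k * (t + u) ^ 2 := by positivity
  have h5 : 0 ≤ k * t ^ 2 * (k * u ^ 2) := by positivity
  have h6 : 0 ≤ k * t ^ 2 := by positivity
  have h7 : 0 ≤ k * u ^ 2 := by positivity
  constructor <;> nlinarith

lemma abs_tan_sub_tan_le {a b c : ℝ} (hc : 0 < c) (ha : c ≤ cos a) (hb : c ≤ cos b) :
    |tan a - tan b| ≤ |a - b| / c ^ 2 := by
  have ha0 := hc.trans_le ha
  have hb0 := hc.trans_le hb
  have e : tan a - tan b = sin (a - b) / (cos a * cos b) := by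
    rw [tan_eq_sin_div_cos, tan_eq_sin_div_cos, sin_sub]; field_simp
  rw [e, abs_div, abs_of_pos (mul_pos ha0 hb0)]
  have h1 : c ^ 2 ≤ cos a * cos b := by nlinarith
  have h2 : |sin (a - b)| ≤ |a - b| := abs_sin_le_abs
  gcongr

/-- For fixed `φ` the displacement is a Lipschitz function of the angle on `[0, θ₀]` which starts at
`0` and ends above `L`. By the intermediate value theorem it covers `[0, L]`, and a Lipschitz map
enlarges one-dimensional Hausdorff measure at most by its constant. No monotonicity is needed. -/
lemma volume_inter_le_of_axialStep {θ₀ φ L : ℝ} (h0 : 0 ≤ θ₀) (h1 : θ₀ < π / 2)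
    (hL : L ≤ axialStep θ₀ φ) (B : Set ℝ) :
    volume (B ∩ Icc 0 L) ≤ ENNReal.ofReal (2 / cos θ₀ ^ 2) *
      volume ({θ | axialStep θ φ ∈ B} ∩ Icc 0 θ₀) := by
  have hc : 0 < cos θ₀ := cos_pos_of_mem_Ioo ⟨by linarith [pi_pos], h1⟩
  have hcos : ∀ θ ∈ Icc 0 θ₀, cos θ₀ ≤ cos θ := fun θ hθ =>
    cos_le_cos_of_nonneg_of_le_pi hθ.1 (by linarith [pi_pos]) hθ.2
  have hlip : LipschitzOnWith (Real.toNNReal (2 / cos θ₀ ^ 2)) (fun θ => axialStep θ φ) (Icc 0 θ₀) := by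
    refine LipschitzOnWith.of_dist_le_mul fun a ha b hb => ?_
    rw [Real.coe_toNNReal _ (by positivity), Real.dist_eq, Real.dist_eq,
      axialStep_eq_tan (hc.trans_le (hcos a ha)).ne', axialStep_eq_tan (hc.trans_le (hcos b hb)).ne',
      ← mul_sub, abs_mul]
    have h2 := abs_div_one_add_sub_le (sq_nonneg (sin φ)) (tan a) (tan b)
    have h3 := abs_tan_sub_tan_le hc (hcos a ha) (hcos b hb)
    have h4 : |2 * cos φ| ≤ 2 := by
      rw [abs_mul, abs_two]; linarith [abs_cos_le_one φ]
    calc _ ≤ 2 * (|a - b| / cos θ₀ ^ 2) := mul_le_mul h4 (h2.trans h3) (abs_nonneg _) zero_le_two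
      _ = _ := by ring
  have himage : B ∩ Icc 0 L ⊆ (fun θ => axialStep θ φ) '' ({θ | axialStep θ φ ∈ B} ∩ Icc 0 θ₀) := by
    rintro y ⟨hyB, hy⟩
    have hiv := intermediate_value_Icc h0 hlip.continuousOn
    have hz : axialStep 0 φ = 0 := by simp [axialStep]
    obtain ⟨θ, hθ, rfl⟩ := hiv (show y ∈ Icc _ _ from ⟨by rw [hz]; exact hy.1, hy.2.trans hL⟩)
    exact ⟨θ, ⟨hyB, hθ⟩, rfl⟩
  have := (hlip.mono (s := {θ | axialStep θ φ ∈ B} ∩ Icc 0 θ₀) inter_subset_right).hausdorffMeasure_image_le zero_le_one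
  rw [hausdorffMeasure_real, ENNReal.rpow_one] at this
  exact (measure_mono himage).trans this

/-- The law of the axial displacement has a density which is bounded below on bounded subintervals
of `[0, ∞)`. -/
lemma exists_smul_volume_le_axialLaw (L : ℝ) (hL : 0 < L) :
    ∃ c : ℝ, 0 < c ∧ ENNReal.ofReal c • volume.restrict (Icc 0 L) ≤ axialLaw := by
  set θ₀ := arctan L with hθ₀
  have h0 : 0 ≤ θ₀ := arctan_nonneg.2 hL.le
  have h1 : θ₀ < π / 2 := arctan_lt_pi_div_two L
  have hc : 0 < cos θ₀ := cos_arctan_pos L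
  -- At `φ = 0` the displacement for the angle `arctan L` is `2 * L`, so it stays above `L` for
  -- small `φ`.
  obtain ⟨δ, hδ, hφ⟩ : ∃ δ > 0, ∀ φ ∈ Icc (-δ) δ, L ≤ axialStep θ₀ φ := by
    have hcont : ContinuousAt (fun φ => 2 * cos φ * (L / (1 + sin φ ^ 2 * L ^ 2))) 0 := by
      refine ContinuousAt.mul (by fun_prop) (ContinuousAt.div (by fun_prop) (by fun_prop) ?_)
      positivity
    have hev := hcont.eventually (lt_mem_nhds (show L < 2 * cos 0 * (L / (1 + sin 0 ^ 2 * L ^ 2)) by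
      simp; linarith))
    obtain ⟨δ, hδ, h⟩ := Metric.eventually_nhds_iff.1 hev
    refine ⟨δ / 2, by positivity, fun φ hφ => ?_⟩
    rw [axialStep_eq_tan hc.ne', hθ₀, tan_arctan]
    refine (h ?_).le
    rw [Real.dist_eq, sub_zero, abs_lt]
    constructor <;> linarith [hφ.1, hφ.2]
  set δ' := min δ (π / 2) with hδ'
  have hδ'0 : 0 < δ' := lt_min hδ (by positivity)
  set c₁ := π⁻¹ * (2 * δ') with hc₁
  set c₂ := cos θ₀ / 2 * (cos θ₀ ^ 2 / 2) with hc₂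
  have hc₁0 : 0 < c₁ := by positivity
  have hc₂0 : 0 < c₂ := by positivity
  refine ⟨c₂ * c₁, by positivity, Measure.le_iff.2 fun B hB => ?_⟩
  have hpre : MeasurableSet ((fun p : ℝ × ℝ => axialStep p.1 p.2) ⁻¹' B) := measurable_axialStep hB
  rw [Measure.smul_apply, smul_eq_mul, Measure.restrict_apply hB, axialLaw,
    Measure.map_apply measurable_axialStep hB, Measure.prod_apply_symm hpre]
  have hfix : ∀ φ ∈ Icc (-δ') δ', ENNReal.ofReal c₂ * volume (B ∩ Icc 0 L) ≤
      lambertLaw ((fun θ => (θ, φ)) ⁻¹' ((fun p : ℝ × ℝ => axialStep p.1 p.2) ⁻¹' B)) := by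
    intro φ hφ'
    have hφL := hφ φ ⟨by linarith [hφ'.1, min_le_left δ (π / 2)], hφ'.2.trans (min_le_left _ _)⟩
    have hAm : MeasurableSet {θ | axialStep θ φ ∈ B} := measurable_prodMk_right hpre
    set A := {θ | axialStep θ φ ∈ B} ∩ Icc 0 θ₀ with hA
    calc ENNReal.ofReal c₂ * volume (B ∩ Icc 0 L)
        ≤ ENNReal.ofReal c₂ * (ENNReal.ofReal (2 / cos θ₀ ^ 2) * volume A) := by
          gcongr; exact volume_inter_le_of_axialStep h0 h1 hφL B
      _ = ENNReal.ofReal (cos θ₀ / 2) * volume A := by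
          rw [← mul_assoc, ← ENNReal.ofReal_mul hc₂0.le]
          congr 2
          rw [hc₂]; field_simp
      _ = ∫⁻ _ in A, ENNReal.ofReal (cos θ₀ / 2) := by rw [setLIntegral_const]
      _ ≤ ∫⁻ θ in A, ENNReal.ofReal (if θ ∈ Ioo (-(π / 2)) (π / 2) then cos θ / 2 else 0) := by
          refine setLIntegral_mono measurable_lambertDensity fun θ hθ => ENNReal.ofReal_le_ofReal ?_
          rw [if_pos ⟨by linarith [hθ.2.1, pi_pos], by linarith [hθ.2.2]⟩]
          linarith [cos_le_cos_of_nonneg_of_le_pi hθ.2.1 (by linarith [pi_pos]) hθ.2.2]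
      _ = lambertLaw A := (withDensity_apply _ (hAm.inter measurableSet_Icc)).symm
      _ ≤ _ := measure_mono inter_subset_left
  calc ENNReal.ofReal (c₂ * c₁) * volume (B ∩ Icc 0 L)
      = ∫⁻ _ in Icc (-δ') δ', ENNReal.ofReal c₂ * volume (B ∩ Icc 0 L) ∂azimuthLaw := by
        rw [setLIntegral_const, azimuthLaw_apply, inter_eq_right.2 (Icc_subset_Icc
          (neg_le_neg (min_le_right _ _)) (min_le_right _ _)), Real.volume_Icc,
          ← ENNReal.ofReal_mul (by positivity), show π⁻¹ * (δ' - -δ') = c₁ by rw [hc₁]; ring,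
          ENNReal.ofReal_mul hc₂0.le]
        ring
    _ ≤ ∫⁻ φ in Icc (-δ') δ', lambertLaw ((fun θ => (θ, φ)) ⁻¹'
          ((fun p : ℝ × ℝ => axialStep p.1 p.2) ⁻¹' B)) ∂azimuthLaw :=
        setLIntegral_mono (measurable_measure_prodMk_right hpre) hfix
    _ ≤ _ := setLIntegral_le_lintegral _ _

end SpreadOut
-- From the light ray to the walk.
section Geometry

/-- The axial displacements of the light ray. -/
noncomputable def axialSteps (θ φ : ℕ → ℝ) : ℕ → ℝ := fun k => axialStep (θ k) (φ k)

lemma S_fst (θ φ : ℕ → ℝ) (n : ℕ) : (S θ φ n).1 = RandomWalk.walk (axialSteps θ φ) n := by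
  induction n with
  | zero => simp [S]
  | succ n ih => rw [RandomWalk.walk_succ, ← ih]; rfl

lemma N_eq_passage (s : ℝ) (θ φ : ℕ → ℝ) : N s θ φ = RandomWalk.passage s (axialSteps θ φ) := by
  simp only [N, RandomWalk.passage, S_fst]

lemma overshoot_eq (s : ℝ) (θ φ : ℕ → ℝ) :
    overshoot s θ φ = RandomWalk.overshoot s (axialSteps θ φ) := by
  rw [overshoot, RandomWalk.overshoot, S_fst, N_eq_passage]

lemma undershoot_eq (s : ℝ) (θ φ : ℕ → ℝ) :
    undershoot s θ φ = RandomWalk.undershoot s (axialSteps θ φ) := by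
  rw [undershoot, RandomWalk.undershoot, S_fst, N_eq_passage]

/-- If the denominator vanishes, `chord` is `0` by the convention for division; this case is
excluded. -/
lemma chord_mul_eq {θ φ : ℝ} (h : chord θ φ ≠ 0) :
    chord θ φ * ((sin φ * sin θ) ^ 2 + cos θ ^ 2) = 2 * cos θ := by
  rw [mul_pow]
  refine div_mul_cancel₀ _ fun h0 => h ?_
  rw [chord, h0, div_zero]

lemma S_snd_sq (θ φ : ℕ → ℝ) (n : ℕ) : (S θ φ n).2.1 ^ 2 + (S θ φ n).2.2 ^ 2 = 1 := by
  induction n with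
  | zero => simp [S]
  | succ n ih =>
    set y := (S θ φ n).2.1 with hy
    set z := (S θ φ n).2.2 with hz
    have e : (S θ φ (n + 1)).2.1 ^ 2 + (S θ φ (n + 1)).2.2 ^ 2 =
        (y + chord (θ n) (φ n) * (-z * sin (φ n) * sin (θ n) - y * cos (θ n))) ^ 2 +
        (z + chord (θ n) (φ n) * (y * sin (φ n) * sin (θ n) - z * cos (θ n))) ^ 2 := rfl
    rw [e]
    by_cases h : chord (θ n) (φ n) = 0
    · rw [h]; simpa using ih
    · have hc := chord_mul_eq h
      have e2 : (y + chord (θ n) (φ n) * (-z * sin (φ n) * sin (θ n) - y * cos (θ n))) ^ 2 +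
          (z + chord (θ n) (φ n) * (y * sin (φ n) * sin (θ n) - z * cos (θ n))) ^ 2 =
          (y ^ 2 + z ^ 2) * (1 + chord (θ n) (φ n) *
            (chord (θ n) (φ n) * ((sin (φ n) * sin (θ n)) ^ 2 + cos (θ n) ^ 2) - 2 * cos (θ n))) := by
        ring
      rw [e2, hc, ih]
      ring

/-- With `r` the fraction of the chord covered, the left side minus `t ^ 2` is `2 * (R * c) * (r *
(r - t))`, whose sign is that of `r - t` for `r > 0`. -/
lemma chord_point_mem_disc_iff {y z R a c r t : ℝ} (hp : y ^ 2 + z ^ 2 = 1)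
    (hR : R * (a ^ 2 + c ^ 2) = 2 * c) (hRc : 0 < R * c) (hr : 0 ≤ r) (ht : 0 < t) :
    (r * (R * (-z * a - y * c)) + y - (1 - t) * y) ^ 2 +
      (r * (R * (y * a - z * c)) + z - (1 - t) * z) ^ 2 ≤ t ^ 2 ↔ r ≤ t := by
  have e : (r * (R * (-z * a - y * c)) + y - (1 - t) * y) ^ 2 +
      (r * (R * (y * a - z * c)) + z - (1 - t) * z) ^ 2 =
      (y ^ 2 + z ^ 2) * (t ^ 2 + r ^ 2 * R * (R * (a ^ 2 + c ^ 2)) - 2 * (r * t) * (R * c)) := by ring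
  rw [e, hp, hR]
  have e2 : 1 * (t ^ 2 + r ^ 2 * R * (2 * c) - 2 * (r * t) * (R * c)) =
      t ^ 2 + 2 * (R * c) * (r * (r - t)) := by ring
  rw [e2, add_le_iff_nonpos_right]
  constructor
  · intro h
    by_contra hlt
    have h1 := not_le.1 hlt
    have : 0 < 2 * (R * c) * (r * (r - t)) :=
      mul_pos (by positivity) (mul_pos (ht.trans h1) (sub_pos.2 h1))
    linarith
  · intro h
    exact mul_nonpos_of_nonneg_of_nonpos (by positivity)
      (mul_nonpos_of_nonneg_of_nonpos hr (sub_nonpos.2 h))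

lemma exitPoint_mem_disc_iff {s t : ℝ} (hs : 0 ≤ s) (ht : 0 < t) {θ φ : ℕ → ℝ}
    (h : 0 < RandomWalk.passage s (axialSteps θ φ)) :
    exitPoint s θ φ ∈ disc t (lastPoint s θ φ) ↔ axialSteps θ φ ∈ RandomWalk.earlySet t s := by
  obtain ⟨n, hn⟩ : ∃ n, N s θ φ = n + 1 := ⟨N s θ φ - 1, by rw [N_eq_passage]; omega⟩
  have hJ := RandomWalk.jump_pos hs h
  have hU := RandomWalk.undershoot_nonneg hs h
  have hpn : RandomWalk.passage s (axialSteps θ φ) - 1 = n := by rw [← N_eq_passage, hn]; rfl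
  have hJe : RandomWalk.jump s (axialSteps θ φ) =
      chord (θ n) (φ n) * (cos (φ n) * sin (θ n)) := by
    rw [RandomWalk.jump, hpn]; rfl
  have hUe : s - (S θ φ n).1 = RandomWalk.undershoot s (axialSteps θ φ) := by
    rw [RandomWalk.undershoot, S_fst, hpn]
  -- The step which passes the level is positive, so degenerate angles are ruled out pathwise,
  -- without a null set.
  have hR0 : chord (θ n) (φ n) ≠ 0 := by
    intro h0
    rw [hJe, h0, zero_mul] at hJ
    exact lt_irrefl _ hJ
  have hR := chord_mul_eq hR0
  have hRc : 0 < chord (θ n) (φ n) * cos (θ n) := by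
    have h1 : 2 * (chord (θ n) (φ n) * cos (θ n)) =
        chord (θ n) (φ n) ^ 2 * ((sin (φ n) * sin (θ n)) ^ 2 + cos (θ n) ^ 2) := by
      linear_combination (-chord (θ n) (φ n)) * hR
    have h2 : (sin (φ n) * sin (θ n)) ^ 2 + cos (θ n) ^ 2 ≠ 0 := by
      intro h0
      rw [h0, mul_zero] at hR
      have hc : cos (θ n) = 0 := by linarith
      exact hR0 (by rw [chord, hc]; simp)
    have h3 : 0 < (sin (φ n) * sin (θ n)) ^ 2 + cos (θ n) ^ 2 := lt_of_le_of_ne (by positivity) h2.symm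
    have h4 : 0 < chord (θ n) (φ n) ^ 2 := by positivity
    have := mul_pos h4 h3
    linarith
  set r := RandomWalk.undershoot s (axialSteps θ φ) / RandomWalk.jump s (axialSteps θ φ) with hr
  have hr0 : 0 ≤ r := div_nonneg hU hJ.le
  have hS : S θ φ (n + 1) = ((S θ φ n).1 + chord (θ n) (φ n) * (cos (φ n) * sin (θ n)),
      (S θ φ n).2.1 + chord (θ n) (φ n) *
        (-(S θ φ n).2.2 * sin (φ n) * sin (θ n) - (S θ φ n).2.1 * cos (θ n)),
      (S θ φ n).2.2 + chord (θ n) (φ n) *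
        ((S θ φ n).2.1 * sin (φ n) * sin (θ n) - (S θ φ n).2.2 * cos (θ n))) := rfl
  have hlast : lastPoint s θ φ = (S θ φ n).2 := by rw [lastPoint, hn, Nat.add_sub_cancel]
  have hexit : exitPoint s θ φ =
      (r * (chord (θ n) (φ n) * (-(S θ φ n).2.2 * (sin (φ n) * sin (θ n)) - (S θ φ n).2.1 * cos (θ n))) +
        (S θ φ n).2.1,
      r * (chord (θ n) (φ n) * ((S θ φ n).2.1 * (sin (φ n) * sin (θ n)) - (S θ φ n).2.2 * cos (θ n))) +
        (S θ φ n).2.2) := by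
    simp only [exitPoint, hn, Nat.add_sub_cancel, hS, hUe, add_sub_cancel_left]
    rw [← hJe, ← hr]
    refine Prod.ext ?_ ?_ <;> simp only <;> ring
  rw [hlast, hexit, disc, mem_ofPred_eq, chord_point_mem_disc_iff (S_snd_sq θ φ n) hR hRc hr0 ht, hr,
    div_le_iff₀ hJ]
  rfl

/-- This makes the statement that the exit point lies in the opening the case `t = 1` of the disc
criterion. -/
lemma disc_one (p : ℝ × ℝ) : disc 1 p = opening := by
  ext q; simp [disc, opening]

lemma exitPoint_mem_opening {s : ℝ} (hs : 0 ≤ s) {θ φ : ℕ → ℝ}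
    (h : 0 < RandomWalk.passage s (axialSteps θ φ)) : exitPoint s θ φ ∈ opening := by
  rw [← disc_one (lastPoint s θ φ), exitPoint_mem_disc_iff hs one_pos h]
  show RandomWalk.undershoot s _ ≤ 1 * RandomWalk.jump s _
  rw [one_mul, ← RandomWalk.overshoot_add_undershoot h]
  linarith [RandomWalk.overshoot_pos h]

end Geometry

/-! ### Areas of the discs and of their complements in the opening. -/

section Area

lemma disc_eq_preimage {t : ℝ} (ht : 0 ≤ t) (p : ℝ × ℝ) :
    disc t p = Complex.measurableEquivRealProd.symm ⁻¹'
      Metric.closedBall (⟨(1 - t) * p.1, (1 - t) * p.2⟩ : ℂ) t := by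
  ext q
  have : Complex.measurableEquivRealProd.symm q = ⟨q.1, q.2⟩ := rfl
  rw [mem_preimage, Metric.mem_closedBall, this, Complex.dist_eq_re_im, sqrt_le_left ht]
  rfl

lemma measurableSet_disc (t : ℝ) (p : ℝ × ℝ) : MeasurableSet (disc t p) :=
  measurableSet_le (by fun_prop) measurable_const

lemma volume_disc {t : ℝ} (ht : 0 ≤ t) (p : ℝ × ℝ) :
    volume (disc t p) = ENNReal.ofReal (π * t ^ 2) := by
  rw [disc_eq_preimage ht,
    Complex.volume_preserving_equiv_real_prod.symm.measure_preimage_equiv, Complex.volume_closedBall,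
    mul_comm, ENNReal.ofReal_mul pi_pos.le, ENNReal.ofReal_pow ht, ← NNReal.coe_real_pi,
    ENNReal.ofReal_coe_nnreal]

lemma volume_real_disc {t : ℝ} (ht : 0 ≤ t) (p : ℝ × ℝ) : volume.real (disc t p) = π * t ^ 2 := by
  rw [measureReal_def, volume_disc ht, ENNReal.toReal_ofReal (by positivity)]

lemma disc_subset_opening {t : ℝ} (ht : t ∈ Ioo (0 : ℝ) 1) {p : ℝ × ℝ} (hp : p.1 ^ 2 + p.2 ^ 2 = 1) :
    disc t p ⊆ opening := by
  intro q hq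
  have h1 : (q.1 - (1 - t) * p.1) ^ 2 + (q.2 - (1 - t) * p.2) ^ 2 ≤ t ^ 2 := hq
  show q.1 ^ 2 + q.2 ^ 2 ≤ 1
  set u := q.1 - (1 - t) * p.1 with hu
  set v := q.2 - (1 - t) * p.2 with hv
  have e1 : q.1 = u + (1 - t) * p.1 := by rw [hu]; ring
  have e2 : q.2 = v + (1 - t) * p.2 := by rw [hv]; ring
  have h2 : u * p.1 + v * p.2 ≤ t := by
    refine le_of_sq_le_sq ?_ ht.1.le
    nlinarith [sq_nonneg (u * p.2 - v * p.1)]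
  have h3 := mul_le_mul_of_nonneg_left h2 (sub_nonneg.2 ht.2.le)
  have e3 : (u + (1 - t) * p.1) ^ 2 + (v + (1 - t) * p.2) ^ 2 = (u ^ 2 + v ^ 2) +
      2 * ((1 - t) * (u * p.1 + v * p.2)) + (1 - t) ^ 2 * (p.1 ^ 2 + p.2 ^ 2) := by ring
  rw [e1, e2, e3, hp]
  nlinarith

lemma volume_opening_diff_disc {t : ℝ} (ht : t ∈ Ioo (0 : ℝ) 1) {p : ℝ × ℝ}
    (hp : p.1 ^ 2 + p.2 ^ 2 = 1) : volume.real (opening \ disc t p) = π * (1 - t ^ 2) := by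
  have hfin : ∀ r, 0 ≤ r → volume (disc r p) ≠ ⊤ := fun r hr => by
    rw [volume_disc hr]; exact ENNReal.ofReal_ne_top
  rw [← disc_one p, measureReal_sdiff (by rw [disc_one]; exact disc_subset_opening ht hp)
    (measurableSet_disc t p) (h₁ := hfin 1 zero_le_one), volume_real_disc zero_le_one,
    volume_real_disc ht.1.le]
  ring

end Area

/-! ### The axial displacements are i.i.d. -/

section Law

variable {Ω : Type*} [MeasurableSpace Ω] {P : Measure Ω} [IsProbabilityMeasure P]
  {Θ Φ : ℕ → Ω → ℝ}

lemma measurable_axialSteps (hΘm : ∀ k, Measurable (Θ k)) (hΦm : ∀ k, Measurable (Φ k)) :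
    Measurable fun ω => axialSteps (fun k => Θ k ω) (fun k => Φ k ω) :=
  measurable_pi_lambda _ fun k => (hΘm k).axialStep (hΦm k)

lemma map_axialSteps [IsProbabilityMeasure axialLaw]
    (hΘm : ∀ k, Measurable (Θ k)) (hΦm : ∀ k, Measurable (Φ k))
    (hΘ : ∀ k, P.map (Θ k) = lambertLaw) (hΦ : ∀ k, P.map (Φ k) = azimuthLaw)
    (hind : iIndepFun (Sum.elim Θ Φ) P) :
    P.map (fun ω => axialSteps (fun k => Θ k ω) (fun k => Φ k ω)) =
      RandomWalk.seqLaw axialLaw := by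
  set X : ℕ × Bool → Ω → ℝ := fun p => if p.2 then Φ p.1 else Θ p.1 with hX
  have hXm : ∀ p, Measurable (X p) := by
    rintro ⟨k, _ | _⟩
    · exact hΘm k
    · exact hΦm k
  have hXi : iIndepFun X P := by
    have := hind.precomp (g := fun p : ℕ × Bool => if p.2 then Sum.inr p.1 else Sum.inl p.1) (by
      rintro ⟨k, _ | _⟩ ⟨l, _ | _⟩ h <;> simp_all)
    convert this using 2 with p
    rcases p with ⟨k, _ | _⟩ <;> simp [hX]
  have hprob : ∀ p, IsProbabilityMeasure (P.map (X p)) := fun p =>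
    Measure.isProbabilityMeasure_map (hXm p).aemeasurable
  -- The pairs of angles are independent of each other: the joint law is a product over `ℕ × Bool`,
  -- and currying makes it a product over `ℕ` of products over `Bool`.
  have hrow : iIndepFun (fun k ω (b : Bool) => X (k, b) ω) P := by
    rw [iIndepFun_iff_map_fun_eq_infinitePi_map (fun k => by fun_prop)]
    have h1 := hXi.map_fun_eq_infinitePi_map hXm
    have h2 : ∀ k, P.map (fun ω (b : Bool) => X (k, b) ω) =
        Measure.infinitePi fun b => P.map (X (k, b)) := fun k =>
      (hXi.precomp (g := fun b : Bool => (k, b)) (Prod.mk_right_injective k)).map_fun_eq_infinitePi_map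
        fun b => hXm (k, b)
    simp_rw [h2]
    rw [← Measure.infinitePi_map_curry (fun k b => P.map (X (k, b)))]
    rw [← h1, Measure.map_map (by fun_prop) (by fun_prop)]
    rfl
  have hstep : iIndepFun (fun k ω => axialStep (Θ k ω) (Φ k ω)) P :=
    hrow.comp (fun _ u => axialStep (u false) (u true)) fun _ =>
      (measurable_pi_apply false).axialStep (measurable_pi_apply true)
  have hlaw : ∀ k, P.map (fun ω => axialStep (Θ k ω) (Φ k ω)) = axialLaw := by
    intro k
    have hpair : IndepFun (Θ k) (Φ k) P :=
      hind.indepFun (i := Sum.inl k) (j := Sum.inr k) (by simp)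
    have h1 := (indepFun_iff_map_prod_eq_prod_map_map (hΘm k).aemeasurable (hΦm k).aemeasurable).1 hpair
    rw [hΘ k, hΦ k] at h1
    rw [axialLaw, ← h1, Measure.map_map measurable_axialStep ((hΘm k).prodMk (hΦm k))]
    rfl
  have := hstep.map_fun_eq_infinitePi_map fun k => (hΘm k).axialStep (hΦm k)
  simp_rw [hlaw] at this
  exact this

end Law
end LambertTube

/-! ### The exit point of the light ray. -/

theorem proposition5p6 {Ω : Type*} [MeasurableSpace Ω] (P : Measure Ω) [IsProbabilityMeasure P]
    (Θ Φ : ℕ → Ω → ℝ)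
    (hΘm : ∀ k, Measurable (Θ k)) (hΦm : ∀ k, Measurable (Φ k))
    (hΘ : ∀ k, P.map (Θ k) = LambertTube.lambertLaw)
    (hΦ : ∀ k, pdf.IsUniform (Φ k) (Icc (-(π / 2)) (π / 2)) P volume)
    (hind : iIndepFun (Sum.elim Θ Φ) P) :
    -- the light leaves the tube almost surely
    (∀ s : ℝ, 0 ≤ s →
      ∀ᵐ ω ∂P, ∃ n : ℕ, 0 < n ∧ s < (LambertTube.S (fun k => Θ k ω) (fun k => Φ k ω) n).1) ∧
    -- the expectations of `O_0` and `O_0 + U_0` are finite, and the first is not zero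
    Integrable (fun ω => LambertTube.overshoot 0 (fun k => Θ k ω) (fun k => Φ k ω)) P ∧
    0 < ∫ ω, LambertTube.overshoot 0 (fun k => Θ k ω) (fun k => Φ k ω) ∂P ∧
    Integrable (fun ω => LambertTube.overshoot 0 (fun k => Θ k ω) (fun k => Φ k ω) +
      LambertTube.undershoot 0 (fun k => Θ k ω) (fun k => Φ k ω)) P ∧
    -- `(a)`
    (∃ G : ℝ → ℝ,
      (∀ t ∈ Ioo (0 : ℝ) 1, Tendsto
        (fun s : ℝ => P.real {ω |
          LambertTube.exitPoint s (fun k => Θ k ω) (fun k => Φ k ω) ∈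
            LambertTube.disc t (LambertTube.lastPoint s (fun k => Θ k ω) (fun k => Φ k ω))})
        atTop (𝓝 (G t))) ∧
      ∀ p : ℝ × ℝ, p.1 ^ 2 + p.2 ^ 2 = 1 →
        Tendsto (fun t => G t / volume.real (LambertTube.disc t p)) (𝓝[>] 0) atTop) ∧
    -- `(b)`
    (∃ H : ℝ → ℝ,
      (∀ t ∈ Ioo (0 : ℝ) 1, Tendsto
        (fun s : ℝ => P.real {ω |
          LambertTube.exitPoint s (fun k => Θ k ω) (fun k => Φ k ω) ∈
            LambertTube.opening \
              LambertTube.disc t (LambertTube.lastPoint s (fun k => Θ k ω) (fun k => Φ k ω))})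
        atTop (𝓝 (H t))) ∧
      ∀ p : ℝ × ℝ, p.1 ^ 2 + p.2 ^ 2 = 1 →
        Tendsto (fun t => H t / volume.real (LambertTube.opening \ LambertTube.disc t p))
          (𝓝[<] 1)
          (𝓝 ((∫ ω, (LambertTube.overshoot 0 (fun k => Θ k ω) (fun k => Φ k ω) +
                LambertTube.undershoot 0 (fun k => Θ k ω) (fun k => Φ k ω)) ∂P) /
            (2 * π * ∫ ω, LambertTube.overshoot 0 (fun k => Θ k ω) (fun k => Φ k ω) ∂P)))) := by
  set T : Ω → ℕ → ℝ := fun ω => LambertTube.axialSteps (fun k => Θ k ω) (fun k => Φ k ω) with hT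
  have hΦ' : ∀ k, P.map (Φ k) = LambertTube.azimuthLaw := hΦ
  -- The total masses need no computation, since these are laws of given random variables.
  have : IsProbabilityMeasure LambertTube.lambertLaw :=
    hΘ 0 ▸ Measure.isProbabilityMeasure_map (hΘm 0).aemeasurable
  have : IsProbabilityMeasure LambertTube.azimuthLaw :=
    hΦ' 0 ▸ Measure.isProbabilityMeasure_map (hΦm 0).aemeasurable
  have : IsProbabilityMeasure LambertTube.axialLaw :=
    Measure.isProbabilityMeasure_map LambertTube.measurable_axialStep.aemeasurable
  set μ := LambertTube.axialLaw with hμ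
  have hTm : Measurable T := LambertTube.measurable_axialSteps hΘm hΦm
  have hlaw : P.map T = RandomWalk.seqLaw μ := LambertTube.map_axialSteps hΘm hΦm hΘ hΦ' hind
  have hdom := LambertTube.exists_smul_volume_le_axialLaw
  have hsym := LambertTube.axialLaw_map_neg
  have hneg := RandomWalk.measure_Iio_ne_zero hsym hdom
  have hpos : ∀ s : ℝ, ∀ᵐ x ∂(RandomWalk.seqLaw μ), 0 < RandomWalk.passage s x :=
    RandomWalk.ae_passage_pos μ hsym hneg
  have hpos' : ∀ s : ℝ, ∀ᵐ ω ∂P, 0 < RandomWalk.passage s (T ω) := fun s =>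
    ae_of_ae_map hTm.aemeasurable (hlaw ▸ hpos s)
  have hJ : Integrable (RandomWalk.jump 0) (RandomWalk.seqLaw μ) :=
    RandomWalk.integrable_jump (hneg _) LambertTube.lintegral_axialLaw_sq_lt_top (hpos 0)
  have hO := RandomWalk.integrable_overshoot (hpos 0) hJ
  have hOpos := RandomWalk.integral_overshoot_pos (hpos 0) hO
  simp only [LambertTube.overshoot_eq, LambertTube.undershoot_eq]
  have eO : ∫ ω, RandomWalk.overshoot 0 (T ω) ∂P =
      ∫ x, RandomWalk.overshoot 0 x ∂(RandomWalk.seqLaw μ) := by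
    rw [← hlaw, integral_map hTm.aemeasurable
      (RandomWalk.measurable_overshoot_level 0).aestronglyMeasurable]
  have hsum : (fun ω => RandomWalk.overshoot 0 (T ω) + RandomWalk.undershoot 0 (T ω)) =ᵐ[P]
      fun ω => RandomWalk.jump 0 (T ω) :=
    (hpos' 0).mono fun ω hω => RandomWalk.overshoot_add_undershoot hω
  have eJ : ∫ ω, (RandomWalk.overshoot 0 (T ω) + RandomWalk.undershoot 0 (T ω)) ∂P =
      ∫ x, RandomWalk.jump 0 x ∂(RandomWalk.seqLaw μ) := by
    rw [integral_congr_ae hsum, ← hlaw, integral_map hTm.aemeasurable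
      (RandomWalk.measurable_jump_level 0).aestronglyMeasurable]
  set m := ∫ x, RandomWalk.overshoot 0 x ∂(RandomWalk.seqLaw μ) with hm
  set I : ℝ → ℝ := fun t =>
    ∫ x, max (t * RandomWalk.jump 0 x - RandomWalk.undershoot 0 x) 0 ∂(RandomWalk.seqLaw μ) with hI
  have hmemdisc : ∀ t ∈ Ioo (0 : ℝ) 1, ∀ s : ℝ, 0 ≤ s →
      P.real {ω | LambertTube.exitPoint s (fun k => Θ k ω) (fun k => Φ k ω) ∈
        LambertTube.disc t (LambertTube.lastPoint s (fun k => Θ k ω) (fun k => Φ k ω))} =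
      RandomWalk.earlyProb μ t s := by
    intro t ht s hs
    rw [RandomWalk.earlyProb, ← hlaw,
      map_measureReal_apply hTm (RandomWalk.measurableSet_earlySet t s)]
    exact measureReal_congr ((hpos' s).mono fun ω hω =>
      propext (LambertTube.exitPoint_mem_disc_iff hs ht.1 hω))
  have hmemdiff : ∀ t ∈ Ioo (0 : ℝ) 1, ∀ s : ℝ, 0 ≤ s →
      P.real {ω | LambertTube.exitPoint s (fun k => Θ k ω) (fun k => Φ k ω) ∈
        LambertTube.opening \
          LambertTube.disc t (LambertTube.lastPoint s (fun k => Θ k ω) (fun k => Φ k ω))} =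
      1 - RandomWalk.earlyProb μ t s := by
    intro t ht s hs
    have hmeas := RandomWalk.measurableSet_earlySet t s
    rw [RandomWalk.earlyProb, ← hlaw, map_measureReal_apply hTm hmeas,
      ← probReal_compl_eq_one_sub (hTm hmeas)]
    exact measureReal_congr ((hpos' s).mono fun ω hω => propext
      ⟨fun h h' => h.2 ((LambertTube.exitPoint_mem_disc_iff hs ht.1 hω).2 h'),
        fun h => ⟨LambertTube.exitPoint_mem_opening hs hω, fun h' =>
          h ((LambertTube.exitPoint_mem_disc_iff hs ht.1 hω).1 h')⟩⟩)
  have hlim : ∀ t ∈ Ioo (0 : ℝ) 1, Tendsto (RandomWalk.earlyProb μ t) atTop (𝓝 (I t / m)) :=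
    fun t ht => RandomWalk.tendsto_earlyProb hpos hdom hO ht.2
  refine ⟨fun s _ => ?_, ?_, ?_, ?_, ⟨fun t => I t / m, fun t ht => ?_, fun p _ => ?_⟩,
    ⟨fun t => 1 - I t / m, fun t ht => ?_, fun p hp => ?_⟩⟩
  · refine (hpos' s).mono fun ω hω => ?_
    simp only [LambertTube.S_fst]
    exact RandomWalk.passage_pos_iff.1 hω
  · exact (hlaw ▸ hO).comp_measurable hTm
  · exact eO ▸ hOpos
  · exact (integrable_congr hsum).2 ((hlaw ▸ hJ).comp_measurable hTm)
  · refine (hlim t ht).congr' ?_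
    filter_upwards [eventually_ge_atTop 0] with s hs using (hmemdisc t ht s hs).symm
  · obtain ⟨κ, hκ, hκI⟩ := RandomWalk.exists_mul_le_integral_max (hpos 0) hO
      (RandomWalk.measure_Ioi_ne_zero hdom 0)
    have hinv : Tendsto (fun t : ℝ => κ / m / π * t⁻¹) (𝓝[>] 0) atTop :=
      tendsto_inv_nhdsGT_zero.const_mul_atTop (by positivity)
    -- The limit probability is at least `t * κ / m` and the area is `π * t ^ 2`, so the quotient
    -- grows at least like `1 / t`.
    refine tendsto_atTop_mono' _ ?_ hinv
    filter_upwards [Ioo_mem_nhdsGT (show (0 : ℝ) < 1 from one_pos)] with t ht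
    have ht0 : 0 < t := ht.1
    rw [LambertTube.volume_real_disc ht0.le]
    calc κ / m / π * t⁻¹ = t * κ / m / (π * t ^ 2) := by field_simp
      _ ≤ I t / m / (π * t ^ 2) := by
        gcongr; exact hκI t ht
  · refine ((hlim t ht).const_sub 1).congr' ?_
    filter_upwards [eventually_ge_atTop 0] with s hs using (hmemdiff t ht s hs).symm
  · rw [eO, eJ]
    have h1 := RandomWalk.tendsto_integral_overshoot_sub_div (hpos 0) hJ
    -- The area is `π * (1 - t) * (1 + t)`. The factor `1 - t` belongs to the difference quotient in
    -- `h1`, and `1 + t → 2` gives the factor 2 in the limit.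
    have h2 : Tendsto (fun t : ℝ => π * (1 + t) * m) (𝓝[<] 1) (𝓝 (π * (1 + 1) * m)) :=
      (((tendsto_id.mono_left nhdsWithin_le_nhds).const_add 1).const_mul π).mul_const m
    have h3 := h1.div h2 (by positivity)
    rw [show π * (1 + 1) * m = 2 * π * m by ring] at h3
    refine h3.congr' ?_
    filter_upwards [Ioo_mem_nhdsLT (show (0 : ℝ) < 1 from one_pos)] with t ht
    rw [LambertTube.volume_opening_diff_disc ht hp]
    have ht1 : (1 - t) ≠ 0 := (sub_pos.2 ht.2).ne'
    have ht2 : (1 + t) ≠ 0 := by linarith [ht.1]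
    have hm0 : m ≠ 0 := hOpos.ne'
    simp only [Pi.div_apply]
    rw [show 1 - t ^ 2 = (1 - t) * (1 + t) by ring, ← hm, show
      (∫ x, max (t * RandomWalk.jump 0 x - RandomWalk.undershoot 0 x) 0 ∂(RandomWalk.seqLaw μ)) = I t
      from rfl]
    field_simp
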